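/- Let $\mathbb F_q$ be a finite field, $n\ge 1$, $V=\mathbb F_q^n$ with standard basis $e_1,\dots,e_n$ and standard bilinear form $a\cdot b=\sum_i a_ib_i$; for $S\subset V$ put $S^\perp=\{u: u\cdot s=0\ \forall s\in S\}$. **Homology with local coefficients.** Let $X$ be a simplicial complex (including the empty simplex, of dimension $-1$) with ordered vertices. A local system $\mathcal F$ on $X$ assigns to each simplex $\sigma$ a module $\mathcal F(\sigma)$ and to each pair $\sigma\subset\tau$ a map $\rho_\sigma^\tau:\mathcal F(\tau)\to\mathcal F(\sigma)$, functorially. Let $C_k(X;\mathcal F)=\bigoplus_{\dim\sigma=k}\mathcal F(\sigma)\sigma$ for $k\ge -1$, with boundary $\partial_k(x\,\sigma)=\sum_{i=1}^{k+1}(-1)^{i+1}\rho^\sigma_{\sigma_i}(x)\,\sigma_i$, where $\sigma_i$ is $\sigma$ without its $i$-th vertex, and $\partial_{-1}=0$. The homology of $(C_k)_{k\ge-1}$ is $\tilde H_*(X;\mathcal F)$. A simplicial map $f:X\to Y$ that is strictly increasing on every simplex induces, for a local system $\mathcal G$ on $Y$ and $(f^{-1}\mathcal G)(\sigma)=\mathcal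 G(f(\sigma))$, a map $f_*:\tilde H_k(X;f^{-1}\mathcal G)\to\tilde H_k(Y;\mathcal G)$, $x\,\sigma\mapsto x\,f(\sigma)$. **The building.** Let $X_V$ be the order complex of the subspaces $0\ne U\subsetneq V$, ordered by inclusion, and let $\mathfrak g$ be the local system $\mathfrak g(U_1\subsetneq\cdots\subsetneq U_\ell)=U_1$, $\mathfrak g(\emptyset)=V$, with the inclusions as connecting maps. Put $\mathcal D^1(V)=\tilde H_{n-2}(X_V;\mathfrak g)$. **The complex $K$.** Let $a_1^0,a_1^1,\dots,a_{n-1}^0,a_{n-1}^1,b$ be distinct, let $M=\{a_1^0,a_1^1\}*\cdots*\{a_{n-1}^0,a_{n-1}^1\}$ be the octahedral $(n-2)$-sphere and $K=M\cup(\{b\}*M^{(n-3)})$, where $M^{(n-3)}$ is the $(n-3)$-skeleton. The simplices of the barycentric subdivision $\mathrm{sd}(K)$ are written $[\sigma_1,\dots,\sigma_{k+1}]$ with $\sigma_1\supsetneq\cdots\supsetneq\sigma_{k+1}$ nonempty simplices of $K$. For distinct vertices $x_1,\dots,x_{n-1}$ spanning a simplex of $K$ let $S(x)=[\{x_1,\dots,x_{n-1}\},\{x_1,\dots,x_{n-2}\},\dots,\{x_1\}]$,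 and for $\pi\in S_{n-1}$ let $\pi(x)=(x_{\pi(1)},\dots,x_{\pi(n-1)})$. For $\epsilon\in\{0,1\}^{n-1}$ let $a^\epsilon=(a_1^{\epsilon_1},\dots,a_{n-1}^{\epsilon_{n-1}})$, and let $a^{\epsilon,j}$ be $a^\epsilon$ with its $j$-th entry replaced by $b$. **The cycles.** Let $T_{q,n}$ be the set of sequences $v=(v_1,\dots,v_{n-1})\in V^{n-1}$ with $v_i\in e_i+\langle e_{i+1},\dots,e_n\rangle$ and $v_i\ne e_i$ for all $i$. For $v\in T_{q,n}$ define $\theta_v(a_i^0)=e_i$, $\theta_v(a_i^1)=v_i$, $\theta_v(b)=e_n$; then $f_v(\sigma)=\langle\theta_v(x):x\in\sigma\rangle^\perp$ defines a simplicial map $f_v:\mathrm{sd}(K)\to X_V$ that is strictly increasing on simplices. Let $v^\epsilon=(u_1,\dots,u_{n-1})$ with $u_i=e_i$ if $\epsilon_i=0$ and $u_i=v_i$ if $\epsilon_i=1$, let $w(v^\epsilon)$ be the unique $w\in\langle u_1,\dots,u_{n-1}\rangle^\perp$ with $w\cdot e_n=1$, and let $\chi(\epsilon,\pi)=(-1)^{\epsilon_1+\cdots+\epsilon_{n-1}}\mathrm{sgn}(\pi)$.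 Let $c_v\in C_{n-2}(\mathrm{sd}(K);f_v^{-1}\mathfrak g)$ be the chain with $$c_v(S(\pi(a^\epsilon)))=\chi(\epsilon,\pi)\,w(v^\epsilon),\qquad c_v(S(\pi(a^{\epsilon,j})))=\chi(\epsilon,\pi)\,\bigl(w(v^{\epsilon+e_j})-w(v^\epsilon)\bigr)\ \text{ if }\epsilon_j=0,$$ for all $\epsilon\in\{0,1\}^{n-1}$, $\pi\in S_{n-1}$, $1\le j\le n-1$ (here $\epsilon+e_j$ is $\epsilon$ with $j$-th entry changed to $1$). **Theorem.** Each $c_v$ is a cycle, and the classes $\tilde c_v=(f_v)_*c_v$, $v\in T_{q,n}$, form an $\mathbb F_q$-basis of $\mathcal D^1(V)=\tilde H_{n-2}(X_V;\mathfrak g)$. -/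

import Mathlib

noncomputable section

namespace TwistedBuilding

open scoped Classical DirectSum

/-! ### Simplicial complexes, local systems and reduced homology -/

/-- An abstract simplicial complex on vertices taken from `S`; the empty simplex is a simplex. -/
structure SimplicialCpx (S : Type*) where
  faces : Set (Finset S)
  empty_mem : ∅ ∈ faces
  down_closed : ∀ {σ τ : Finset S}, τ ∈ faces → σ ⊆ τ → σ ∈ faces

/-- A simplicial complex whose vertices carry an order relation that is a strict linear order on
each simplex.  Simplices are written with increasing vertices, so only the restriction of the order
to the simplices matters for the chain complex. -/
structure OrderedCpx (S : Type*) extends SimplicialCpx S where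
  lt : S → S → Prop
  lt_strict : ∀ σ ∈ faces, IsStrictTotalOrder {s : S // s ∈ σ} (fun s t => lt s.1 t.1)

/-- The order complex of a poset: the simplices are the finite chains. -/
def orderComplex (P : Type*) [PartialOrder P] : OrderedCpx P where
  faces := {σ | IsChain (· ≤ ·) (σ : Set P)}
  empty_mem := by simp
  down_closed := fun hτ hσ => hτ.mono (by exact_mod_cast hσ)
  lt := (· < ·)
  lt_strict := fun σ hσ =>
    { trichotomous := fun a b h1 h2 => by
        by_contra hne
        have hne' : a.1 ≠ b.1 := fun h => hne (Subtype.ext h)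
        rcases hσ a.2 b.2 hne' with h | h
        · exact h1 (lt_of_le_of_ne h hne')
        · exact h2 (lt_of_le_of_ne h hne'.symm)
      irrefl := fun a => lt_irrefl a.1
      trans := fun _ _ _ h1 h2 => lt_trans h1 h2 }

variable {S : Type*} {S' : Type*}

/-- The simplices with exactly `k` vertices, i.e. those of dimension `k - 1`. -/
@[ext]
structure OrderedCpx.Simplex (X : OrderedCpx S) (k : ℕ) where
  val : X.faces
  card_eq : val.1.card = k

/-- The face of `σ` opposite to its vertex `s`. -/
def OrderedCpx.Simplex.face {X : OrderedCpx S} {k : ℕ} (σ : X.Simplex (k + 1))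
    (s : {s : S // s ∈ σ.1.1}) : X.Simplex k :=
  ⟨⟨σ.1.1.erase s.1, X.down_closed σ.1.2 (Finset.erase_subset _ _)⟩, by
    rw [Finset.card_erase_of_mem s.2, σ.2]; rfl⟩

/-- If `s` is the `i`-th vertex of `σ` (counted from `1` in increasing order), this is
`(-1) ^ (i - 1) = (-1) ^ (i + 1)`. -/
def OrderedCpx.Simplex.sgn {X : OrderedCpx S} {k : ℕ} (σ : X.Simplex k)
    (s : {s : S // s ∈ σ.1.1}) : ℤ :=
  (-1) ^ (σ.1.1.filter (fun t => X.lt t s.1)).card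

/-- A local system of `R`-modules on a simplicial complex. -/
structure LocalSystem (R : Type*) [Ring R] (X : OrderedCpx S) where
  obj : X.faces → Type*
  [addCommGroup : ∀ σ, AddCommGroup (obj σ)]
  [module : ∀ σ, Module R (obj σ)]
  res : ∀ {σ τ : X.faces}, σ.1 ⊆ τ.1 → obj τ →ₗ[R] obj σ
  res_id : ∀ (σ : X.faces) (x : obj σ), res (Finset.Subset.refl σ.1) x = x
  res_comp : ∀ {η σ τ : X.faces} (h : η.1 ⊆ σ.1) (h' : σ.1 ⊆ τ.1) (x : obj τ),
    res h (res h' x) = res (h.trans h') x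

attribute [instance] LocalSystem.addCommGroup LocalSystem.module

namespace LocalSystem

variable {R : Type*} [Ring R] {X : OrderedCpx S} {Y : OrderedCpx S'}

/-- Twisted chains supported on the simplices with `k` vertices (degree `k - 1`). In particular
`Chain 0` is the group of chains of degree `-1`, supported on the empty simplex. -/
abbrev Chain (A : LocalSystem R X) (k : ℕ) : Type _ := ⨁ σ : X.Simplex k, A.obj σ.1

/-- The chain `x · σ`. -/
abbrev single (A : LocalSystem R X) {k : ℕ} (σ : X.Simplex k) : A.obj σ.1 →ₗ[R] A.Chain k :=
  DirectSum.lof R (X.Simplex k) (fun σ => A.obj σ.1) σ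

/-- The boundary map from degree `k` to degree `k - 1`. -/
def boundary (A : LocalSystem R X) (k : ℕ) : A.Chain (k + 1) →ₗ[R] A.Chain k :=
  DirectSum.toModule R (X.Simplex (k + 1)) (A.Chain k) fun σ =>
    ∑ s : {s : S // s ∈ σ.1.1},
      σ.sgn s • (A.single (σ.face s) ∘ₗ A.res (Finset.erase_subset s.1 σ.1.1))

theorem boundary_single (A : LocalSystem R X) {k : ℕ} (σ : X.Simplex (k + 1)) (x : A.obj σ.1) :
    A.boundary k (A.single σ x) = ∑ s : {s : S // s ∈ σ.1.1},
      σ.sgn s • A.single (σ.face s) (A.res (Finset.erase_subset s.1 σ.1.1) x) := by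
  rw [boundary, single, DirectSum.toModule_lof, LinearMap.sum_apply]
  rfl

/-- Cycles of degree `k - 1`; in degree `-1` every chain is a cycle. -/
def cycles (A : LocalSystem R X) : (k : ℕ) → Submodule R (A.Chain k)
  | 0 => ⊤
  | k + 1 => LinearMap.ker (A.boundary k)

/-- Boundaries of degree `k - 1`. -/
def boundaries (A : LocalSystem R X) (k : ℕ) : Submodule R (A.Chain k) :=
  LinearMap.range (A.boundary k)

/-- The reduced homology in degree `k - 1`: cycles modulo boundaries. -/
abbrev ReducedHomology (A : LocalSystem R X) (k : ℕ) : Type _ :=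
  A.cycles k ⧸ (A.boundaries k).comap (A.cycles k).subtype

/-- The homology class of a cycle. -/
def homologyClass (A : LocalSystem R X) {k : ℕ} (c : A.Chain k) (hc : c ∈ A.cycles k) :
    A.ReducedHomology k :=
  Submodule.Quotient.mk ⟨c, hc⟩

end LocalSystem

/-- A simplicial map that is strictly increasing on each simplex; in particular it preserves the
dimension of every simplex. -/
structure OrderedMap (X : OrderedCpx S) (Y : OrderedCpx S') where
  toFun : S → S'
  map_faces : ∀ σ ∈ X.faces, σ.image toFun ∈ Y.faces
  map_lt : ∀ σ ∈ X.faces, ∀ s ∈ σ, ∀ t ∈ σ, X.lt s t → Y.lt (toFun s) (toFun t)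

namespace OrderedMap

variable {R : Type*} [Ring R] {X : OrderedCpx S} {Y : OrderedCpx S'} (f : OrderedMap X Y)

theorem map_lt_iff {σ : Finset S} (hσ : σ ∈ X.faces) {s t : S} (hs : s ∈ σ) (ht : t ∈ σ) :
    Y.lt (f.toFun s) (f.toFun t) ↔ X.lt s t := by
  refine ⟨fun h => ?_, f.map_lt σ hσ s hs t ht⟩
  have hX := X.lt_strict σ hσ
  have hY := Y.lt_strict _ (f.map_faces σ hσ)
  have ms : f.toFun s ∈ σ.image f.toFun := Finset.mem_image_of_mem _ hs
  have mt : f.toFun t ∈ σ.image f.toFun := Finset.mem_image_of_mem _ ht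
  by_contra hn
  by_cases h' : X.lt t s
  · have h2 := f.map_lt σ hσ t ht s hs h'
    exact hY.irrefl ⟨_, ms⟩ (hY.trans ⟨_, ms⟩ ⟨_, mt⟩ ⟨_, ms⟩ h h2)
  · have : (⟨s, hs⟩ : {s : S // s ∈ σ}) = ⟨t, ht⟩ := hX.trichotomous _ _ hn h'
    have e : s = t := congrArg Subtype.val this
    subst e
    exact hY.irrefl ⟨_, ms⟩ h

theorem injOn {σ : Finset S} (hσ : σ ∈ X.faces) : Set.InjOn f.toFun (σ : Set S) := by
  intro s hs t ht h
  have hX := X.lt_strict σ hσ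
  have hY := Y.lt_strict _ (f.map_faces σ hσ)
  have mt : f.toFun t ∈ σ.image f.toFun := Finset.mem_image_of_mem _ ht
  have key : (⟨s, hs⟩ : {s : S // s ∈ σ}) = ⟨t, ht⟩ := by
    refine hX.trichotomous _ _ (fun h1 => ?_) (fun h1 => ?_)
    · have := f.map_lt σ hσ s hs t ht h1
      rw [h] at this
      exact hY.irrefl ⟨_, mt⟩ this
    · have := f.map_lt σ hσ t ht s hs h1
      rw [h] at this
      exact hY.irrefl ⟨_, mt⟩ this
  exact congrArg Subtype.val key

/-- The image of a simplex. -/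
def mapFace (σ : X.faces) : Y.faces := ⟨σ.1.image f.toFun, f.map_faces σ.1 σ.2⟩

/-- The image of a simplex with `k` vertices, again a simplex with `k` vertices. -/
abbrev mapSimplex {k : ℕ} (σ : X.Simplex k) : Y.Simplex k :=
  ⟨f.mapFace σ.1, (Finset.card_image_of_injOn (f.injOn σ.1.2)).trans σ.2⟩

/-- The inverse image of a local system, `(f⁻¹ A)(σ) = A (f σ)`. -/
abbrev pullback (A : LocalSystem R Y) : LocalSystem R X where
  obj σ := A.obj (f.mapFace σ)
  res h := A.res (Finset.image_subset_image h)
  res_id _ x := A.res_id _ x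
  res_comp _ _ x := A.res_comp _ _ x

/-- The map on chains induced by `f`: it sends `x · σ` to `x · f(σ)`. -/
def chainMap (A : LocalSystem R Y) (k : ℕ) : (f.pullback A).Chain k →ₗ[R] A.Chain k :=
  DirectSum.toModule R (X.Simplex k) (A.Chain k) fun σ => A.single (f.mapSimplex σ)

theorem chainMap_single (A : LocalSystem R Y) {k : ℕ} (σ : X.Simplex k)
    (x : (f.pullback A).obj σ.1) :
    f.chainMap A k ((f.pullback A).single σ x) = A.single (f.mapSimplex σ) x := by
  rw [chainMap, LocalSystem.single, DirectSum.toModule_lof]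

theorem single_congr (A : LocalSystem R Y) {k : ℕ} {τ τ' : Y.Simplex k} (h : τ = τ')
    {υ : Y.faces} (h1 : τ.1.1 ⊆ υ.1) (h2 : τ'.1.1 ⊆ υ.1) (x : A.obj υ) :
    A.single τ (A.res h1 x) = A.single τ' (A.res h2 x) := by
  subst h; rfl

theorem chainMap_boundary (A : LocalSystem R Y) (k : ℕ) (c : (f.pullback A).Chain (k + 1)) :
    f.chainMap A k ((f.pullback A).boundary k c) = A.boundary k (f.chainMap A (k + 1) c) := by
  suffices h : f.chainMap A k ∘ₗ (f.pullback A).boundary k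
      = A.boundary k ∘ₗ f.chainMap A (k + 1) from LinearMap.congr_fun h c
  refine DirectSum.linearMap_ext (M := fun σ : X.Simplex (k + 1) => (f.pullback A).obj σ.1) R
    fun σ => ?_
  refine LinearMap.ext fun x => ?_
  have hinj := f.injOn σ.1.2
  change f.chainMap A k ((f.pullback A).boundary k ((f.pullback A).single σ x))
    = A.boundary k (f.chainMap A (k + 1) ((f.pullback A).single σ x))
  rw [chainMap_single, LocalSystem.boundary_single, LocalSystem.boundary_single, map_sum]
  let e : {s : S // s ∈ σ.1.1} → {t : S' // t ∈ (f.mapSimplex σ).1.1} :=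
    fun s => ⟨f.toFun s.1, Finset.mem_image_of_mem _ s.2⟩
  have he : Function.Bijective e := by
    constructor
    · intro s t h
      exact Subtype.ext (hinj s.2 t.2 (congrArg Subtype.val h))
    · rintro ⟨t, ht⟩
      obtain ⟨s, hs, rfl⟩ := Finset.mem_image.1 ht
      exact ⟨⟨s, hs⟩, rfl⟩
  refine Fintype.sum_bijective (M := A.Chain k) e he _ _ fun s => ?_
  have hsgn : σ.sgn s = (f.mapSimplex σ).sgn (e s) := by
    unfold OrderedCpx.Simplex.sgn
    congr 1
    have : (f.mapSimplex σ).1.1.filter (fun t => Y.lt t (e s).1)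
        = (σ.1.1.filter (fun t => X.lt t s.1)).image f.toFun := by
      ext t
      simp only [Finset.mem_filter, Finset.mem_image]
      constructor
      · rintro ⟨ht, hlt⟩
        obtain ⟨u, hu, rfl⟩ := Finset.mem_image.1 ht
        exact ⟨u, ⟨hu, (f.map_lt_iff σ.1.2 hu s.2).1 hlt⟩, rfl⟩
      · rintro ⟨u, ⟨hu, hlt⟩, rfl⟩
        exact ⟨Finset.mem_image_of_mem _ hu, (f.map_lt_iff σ.1.2 hu s.2).2 hlt⟩
    rw [this, Finset.card_image_of_injOn]
    exact hinj.mono (by exact_mod_cast Finset.filter_subset _ _)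
  have hface : f.mapSimplex (σ.face s) = (f.mapSimplex σ).face (e s) := by
    apply OrderedCpx.Simplex.ext
    apply Subtype.ext
    change (σ.1.1.erase s.1).image f.toFun = (σ.1.1.image f.toFun).erase (f.toFun s.1)
    ext t
    simp only [Finset.mem_image, Finset.mem_erase]
    constructor
    · rintro ⟨u, ⟨hu, hm⟩, rfl⟩
      exact ⟨fun h => hu (hinj hm s.2 h), u, hm, rfl⟩
    · rintro ⟨ht, u, hm, rfl⟩
      exact ⟨u, ⟨fun h => ht (by rw [h]), hm⟩, rfl⟩
  rw [← hsgn, map_zsmul, chainMap_single]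
  congr 1
  exact single_congr A hface _ _ x

theorem chainMap_mem_cycles (A : LocalSystem R Y) (k : ℕ) :
    ∀ c ∈ (f.pullback A).cycles k, f.chainMap A k c ∈ A.cycles k := by
  cases k with
  | zero => intro c _; exact Submodule.mem_top
  | succ k =>
    intro c hc
    have hc' : (f.pullback A).boundary k c = 0 := hc
    change A.boundary k _ = 0
    rw [← f.chainMap_boundary, hc', map_zero]

/-- The map `f_*` induced on reduced homology. -/
def homologyMap (A : LocalSystem R Y) (k : ℕ) :
    (f.pullback A).ReducedHomology k →ₗ[R] A.ReducedHomology k :=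
  Submodule.mapQ _ _ ((f.chainMap A k).restrict (f.chainMap_mem_cycles A k)) (by
    rintro ⟨c, hc⟩ ⟨d, hd⟩
    exact ⟨f.chainMap A (k + 1) d, by rw [← f.chainMap_boundary, hd]; rfl⟩)

end OrderedMap

/-- The vertices of the barycentric subdivision of `K`: the nonempty simplices of `K`, the larger
ones coming first. -/
@[ext]
structure SdVertex (K : SimplicialCpx S) where
  val : Finset S
  property : val ∈ K.faces ∧ val.Nonempty

/-- Reverse inclusion. -/
instance (K : SimplicialCpx S) : PartialOrder (SdVertex K) :=
  PartialOrder.lift (fun σ => OrderDual.toDual σ.val) fun _ _ h => SdVertex.ext h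

/-- The barycentric subdivision of `K`. -/
abbrev sd (K : SimplicialCpx S) : OrderedCpx (SdVertex K) := orderComplex (SdVertex K)

/-! ### The building and its tautological local system

Throughout `n = m + 1` and `V = Fⁿ`, with coordinates indexed by `Fin (m + 1)`. -/

variable (F : Type*) [Field F] (m : ℕ)

/-- The nontrivial proper subspaces of `V`. -/
@[ext]
structure ProperSubspace where
  val : Submodule F (Fin (m + 1) → F)
  property : val ≠ ⊥ ∧ val ≠ ⊤

/-- Inclusion. -/
instance : PartialOrder (ProperSubspace F m) :=
  PartialOrder.lift ProperSubspace.val fun _ _ h => ProperSubspace.ext h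

/-- The building of `GL(V)`. -/
abbrev building : OrderedCpx (ProperSubspace F m) := orderComplex (ProperSubspace F m)

variable {F m}

/-- The smallest member of a flag, and `V` for the empty flag, written as the intersection of the
members of the flag. -/
def bottom (σ : Finset (ProperSubspace F m)) : Submodule F (Fin (m + 1) → F) where
  carrier := {u | ∀ U ∈ σ, u ∈ U.1}
  add_mem' := fun ha hb U hU => U.1.add_mem (ha U hU) (hb U hU)
  zero_mem' := fun U _ => U.1.zero_mem
  smul_mem' := fun c _ hx U hU => U.1.smul_mem c (hx U hU)

theorem bottom_empty : bottom (∅ : Finset (ProperSubspace F m)) = ⊤ :=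
  eq_top_iff.2 fun _ _ U hU => (Finset.notMem_empty U hU).elim

theorem bottom_eq {σ : Finset (ProperSubspace F m)} {U : ProperSubspace F m} (hU : U ∈ σ)
    (hmin : ∀ W ∈ σ, U ≤ W) : bottom σ = U.1 :=
  le_antisymm (fun _ hu => hu U hU) (fun _ hu W hW => hmin W hW hu)

theorem bottom_anti {σ τ : Finset (ProperSubspace F m)} (h : σ ⊆ τ) : bottom τ ≤ bottom σ :=
  fun _ hu U hU => hu U (h hU)

/-- The inclusion of the smallest members of flags. -/
def bottomIncl {σ τ : Finset (ProperSubspace F m)} (h : σ ⊆ τ) : bottom τ →ₗ[F] bottom σ :=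
  Submodule.inclusion (bottom_anti h)

theorem coe_bottomIncl {σ τ : Finset (ProperSubspace F m)} (h : σ ⊆ τ) (x : bottom τ) :
    (bottomIncl h x : Fin (m + 1) → F) = x :=
  Submodule.coe_inclusion (bottom_anti h) x

theorem bottomIncl_refl (σ : Finset (ProperSubspace F m)) (x : bottom σ) :
    bottomIncl (Finset.Subset.refl σ) x = x := rfl

theorem bottomIncl_comp {η σ τ : Finset (ProperSubspace F m)} (h : η ⊆ σ) (h' : σ ⊆ τ)
    (x : bottom τ) : bottomIncl h (bottomIncl h' x) = bottomIncl (h.trans h') x :=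
  Subtype.ext (by rw [coe_bottomIncl, coe_bottomIncl, coe_bottomIncl])

variable (F m) in
/-- The local system `𝔤`, with `𝔤(U₁ ⊂ ⋯ ⊂ U_ℓ) = U₁`, `𝔤(∅) = V`, and inclusions as connecting
maps. -/
abbrev taut : LocalSystem F (building F m) where
  obj σ := bottom σ.1
  res h := bottomIncl h
  res_id σ x := bottomIncl_refl σ.1 x
  res_comp h h' x := bottomIncl_comp h h' x

variable (F m) in
/-- `D¹(V)`: the reduced homology of the building in degree `n - 2` (simplices with `n - 1 = m`
vertices) with coefficients in `𝔤`. -/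
abbrev D1 : Type _ := (taut F m).ReducedHomology m

/-! ### The complex `K` -/

/-- The vertices `a_i^0 = a i false`, `a_i^1 = a i true` (for `i` in a set of size `m = n - 1`)
and `b`. -/
inductive Vertex (m : ℕ) : Type
  | a (i : Fin m) (ε : Bool) : Vertex m
  | b : Vertex m

/-- The octahedral sphere, the join of the `m` two-point complexes `{a_i^0, a_i^1}`. -/
def octahedron (m : ℕ) : SimplicialCpx (Vertex m) where
  faces := {σ | Vertex.b ∉ σ ∧ ∀ i, ¬ (Vertex.a i false ∈ σ ∧ Vertex.a i true ∈ σ)}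
  empty_mem := by simp
  down_closed := fun h hs => ⟨fun hb => h.1 (hs hb), fun i hi => h.2 i ⟨hs hi.1, hs hi.2⟩⟩

/-- `K = M ∪ ({b} * M^{(n-3)})`, with `M` the octahedral sphere; the simplices of the skeleton
`M^{(n-3)}` are those with fewer than `m = n - 1` vertices. -/
def coneComplex (m : ℕ) : SimplicialCpx (Vertex m) where
  faces := {σ | σ ∈ (octahedron m).faces ∨
    ∃ τ ∈ (octahedron m).faces, τ.card < m ∧ (σ = τ ∨ σ = insert Vertex.b τ)}
  empty_mem := Or.inl (octahedron m).empty_mem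
  down_closed := by
    rintro σ τ (h | ⟨ρ, h, hc, (rfl | rfl)⟩) hs
    · exact Or.inl ((octahedron m).down_closed h hs)
    · exact Or.inl ((octahedron m).down_closed h hs)
    · by_cases hb : Vertex.b ∈ σ
      · have hsub : σ.erase Vertex.b ⊆ ρ := fun x hx =>
          (Finset.mem_insert.1 (hs (Finset.mem_of_mem_erase hx))).resolve_left
            (Finset.ne_of_mem_erase hx)
        exact Or.inr ⟨σ.erase Vertex.b, (octahedron m).down_closed h hsub,
          (Finset.card_le_card hsub).trans_lt hc, Or.inr (Finset.insert_erase hb).symm⟩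
      · exact Or.inl ((octahedron m).down_closed h fun x hx =>
          (Finset.mem_insert.1 (hs hx)).resolve_left fun e => hb (e ▸ hx))

/-- For a sequence `x` of distinct vertices spanning a simplex, the vertex
`{x_1, …, x_{k+1}}` of the barycentric subdivision. -/
def prefixVertex {K : SimplicialCpx S} {k : ℕ} (x : Fin k → S)
    (hx : Finset.univ.image x ∈ K.faces) (i : Fin k) : SdVertex K :=
  ⟨(Finset.Iic i).image x,
    K.down_closed hx (Finset.image_subset_image (Finset.subset_univ _)),
    ⟨x i, Finset.mem_image_of_mem _ (Finset.mem_Iic.2 le_rfl)⟩⟩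

theorem prefixVertex_injective {K : SimplicialCpx S} {k : ℕ} (x : Fin k → S)
    (hx : Finset.univ.image x ∈ K.faces) (hinj : Function.Injective x) :
    Function.Injective (prefixVertex x hx) := by
  intro i j h
  have h' : (Finset.Iic i).image x = (Finset.Iic j).image x := congrArg SdVertex.val h
  have := Finset.image_injective hinj h'
  apply le_antisymm
  · exact Finset.mem_Iic.1 (this ▸ Finset.mem_Iic.2 le_rfl)
  · exact Finset.mem_Iic.1 (this ▸ Finset.mem_Iic.2 le_rfl)

/-- The simplex `S(x) = [{x_1, …, x_k}, {x_1, …, x_{k-1}}, …, {x_1}]`. -/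
def flagSimplex {K : SimplicialCpx S} {k : ℕ} (x : Fin k → S)
    (hx : Finset.univ.image x ∈ K.faces) (hinj : Function.Injective x) : (sd K).Simplex k :=
  ⟨⟨Finset.univ.image (prefixVertex x hx), by
    intro s hs t ht _
    obtain ⟨i, -, rfl⟩ := Finset.mem_image.1 (Finset.mem_coe.1 hs)
    obtain ⟨j, -, rfl⟩ := Finset.mem_image.1 (Finset.mem_coe.1 ht)
    rcases le_total i j with h | h
    · exact Or.inr (Finset.image_subset_image (Finset.Iic_subset_Iic.2 h))
    · exact Or.inl (Finset.image_subset_image (Finset.Iic_subset_Iic.2 h))⟩, by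
    rw [Finset.card_image_of_injective _ (prefixVertex_injective x hx hinj), Finset.card_univ,
      Fintype.card_fin]⟩

/-- The sequence `a^ε`. -/
def seqA (ε : Fin m → Bool) (i : Fin m) : Vertex m := Vertex.a i (ε i)

/-- The sequence `a^{ε,j}`, with `b` in place `j`. -/
def seqAB (ε : Fin m → Bool) (j : Fin m) (i : Fin m) : Vertex m :=
  if i = j then Vertex.b else Vertex.a i (ε i)

theorem seqA_injective (ε : Fin m → Bool) : Function.Injective (seqA ε) := by
  intro i j h
  simp only [seqA, Vertex.a.injEq] at h
  exact h.1

theorem seqAB_injective (ε : Fin m → Bool) (j : Fin m) : Function.Injective (seqAB ε j) := by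
  intro i i' h
  unfold seqAB at h
  split_ifs at h with h1 h2 h2
  · rw [h1, h2]
  · simp only [Vertex.a.injEq] at h
    exact h.1

theorem seqA_mem (ε : Fin m → Bool) (π : Equiv.Perm (Fin m)) :
    Finset.univ.image (seqA ε ∘ π) ∈ (coneComplex m).faces := by
  refine Or.inl ⟨by simp [seqA], fun i h => ?_⟩
  simp only [Finset.mem_image, Finset.mem_univ, true_and, Function.comp_apply, seqA,
    Vertex.a.injEq] at h
  obtain ⟨⟨j, h1, h2⟩, ⟨k, h3, h4⟩⟩ := h
  rw [h1] at h2
  rw [h3, h2] at h4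
  exact Bool.noConfusion h4

theorem seqAB_mem (ε : Fin m → Bool) (j : Fin m) (π : Equiv.Perm (Fin m)) :
    Finset.univ.image (seqAB ε j ∘ π) ∈ (coneComplex m).faces := by
  refine Or.inr ⟨(Finset.univ.erase j).image (seqA ε), ⟨by simp [seqA], fun i h => ?_⟩, ?_,
    Or.inr ?_⟩
  · simp only [Finset.mem_image, Finset.mem_erase, Finset.mem_univ, and_true, seqA,
      Vertex.a.injEq] at h
    obtain ⟨⟨j, -, h1, h2⟩, ⟨k, -, h3, h4⟩⟩ := h
    rw [h1] at h2
    rw [h3, h2] at h4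
    exact Bool.noConfusion h4
  · rw [Finset.card_image_of_injective _ (seqA_injective ε)]
    have := Finset.card_erase_lt_of_mem (Finset.mem_univ j)
    simpa using this
  · ext x
    simp only [Finset.mem_image, Finset.mem_univ, true_and, Function.comp_apply,
      Finset.mem_insert, Finset.mem_erase, and_true]
    constructor
    · rintro ⟨i, rfl⟩
      by_cases h : π i = j
      · exact Or.inl (by simp [seqAB, h])
      · exact Or.inr ⟨π i, h, by simp [seqAB, seqA, h]⟩
    · rintro (rfl | ⟨i, hi, rfl⟩)
      · exact ⟨π.symm j, by simp [seqAB]⟩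
      · exact ⟨π.symm i, by simp [seqAB, seqA, hi]⟩

/-! ### The index set, the simplicial map and the cycle -/

variable (F) in
/-- The standard basis vector. -/
def stdVec (p : Fin (m + 1)) : Fin (m + 1) → F := Pi.single p 1

variable (F m) in
/-- The set `T_{q,n}`: sequences `(v_1, …, v_{n-1})` with `v_i ∈ e_i + ⟨e_{i+1}, …, e_n⟩` and
`v_i ≠ e_i`. -/
abbrev IndexT : Type _ :=
  {v : Fin m → (Fin (m + 1) → F) // ∀ i : Fin m,
    v i - stdVec F i.castSucc ∈ Submodule.span F (stdVec F '' Set.Ioi i.castSucc) ∧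
    v i ≠ stdVec F i.castSucc}

/-- `S^⊥` with respect to the standard bilinear form. -/
def perp (A : Set (Fin (m + 1) → F)) : Submodule F (Fin (m + 1) → F) where
  carrier := {u | ∀ s ∈ A, u ⬝ᵥ s = 0}
  add_mem' := fun ha hb s hs => by rw [add_dotProduct, ha s hs, hb s hs, add_zero]
  zero_mem' := fun s _ => zero_dotProduct s
  smul_mem' := fun c x hx s hs => by rw [smul_dotProduct, hx s hs, smul_zero]

/-- The labelling of the vertices of `K` by vectors: `a_i^0 ↦ e_i`, `a_i^1 ↦ v_i`, `b ↦ e_n`. -/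
def theta (v : IndexT F m) : Vertex m → (Fin (m + 1) → F)
  | Vertex.a i false => stdVec F i.castSucc
  | Vertex.a i true => v.1 i
  | Vertex.b => stdVec F (Fin.last m)

/-- The position of the leading entry of `theta v x`. -/
def Vertex.pos : Vertex m → Fin (m + 1)
  | Vertex.a i _ => i.castSucc
  | Vertex.b => Fin.last m

theorem coord_eq_zero {q p : Fin (m + 1)} {u : Fin (m + 1) → F}
    (hu : u ∈ Submodule.span F (stdVec F '' Set.Ioi q)) (hp : p ≤ q) : u p = 0 := by
  have h : Submodule.span F (stdVec F '' Set.Ioi q)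
      ≤ LinearMap.ker (LinearMap.proj p : (Fin (m + 1) → F) →ₗ[F] F) := by
    rw [Submodule.span_le]
    rintro _ ⟨r, hr, rfl⟩
    exact Pi.single_eq_of_ne (hp.trans_lt hr).ne _
  exact h hu

theorem theta_lower (v : IndexT F m) (x : Vertex m) {p : Fin (m + 1)} (hp : p < x.pos) :
    theta v x p = 0 := by
  cases x with
  | a i ε =>
    cases ε with
    | false => exact Pi.single_eq_of_ne hp.ne _
    | true =>
      have h := coord_eq_zero (F := F) (v.2 i).1 hp.le
      have e : stdVec F i.castSucc p = 0 := Pi.single_eq_of_ne hp.ne _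
      rw [Pi.sub_apply, e, sub_zero] at h
      exact h
  | b => exact Pi.single_eq_of_ne hp.ne _

theorem theta_pos (v : IndexT F m) (x : Vertex m) : theta v x x.pos = 1 := by
  cases x with
  | a i ε =>
    cases ε with
    | false => exact Pi.single_eq_same _ _
    | true =>
      have h := coord_eq_zero (F := F) (v.2 i).1 le_rfl
      have e : stdVec F i.castSucc i.castSucc = 1 := Pi.single_eq_same _ _
      rw [Pi.sub_apply, e, sub_eq_zero] at h
      exact h
  | b => exact Pi.single_eq_same _ _

theorem exists_dual (v : IndexT F m) {σ : Finset (Vertex m)}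
    (hσ : Set.InjOn Vertex.pos (σ : Set (Vertex m))) (p : Fin (m + 1)) :
    ∃ w : Fin (m + 1) → F, w ≠ 0 ∧ ∀ x ∈ σ, w ⬝ᵥ theta v x = if x.pos = p then 1 else 0 := by
  let g : Fin (m + 1) → Fin (m + 1) → F := fun r =>
    if h : ∃ x ∈ σ, x.pos = r then theta v h.choose else stdVec F r
  have hg : ∀ x ∈ σ, g x.pos = theta v x := by
    intro x hx
    have h : ∃ y ∈ σ, y.pos = x.pos := ⟨x, hx, rfl⟩
    have e : h.choose = x := hσ h.choose_spec.1 hx h.choose_spec.2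
    simp only [g, dif_pos h, e]
  have hlow : ∀ r s, s < r → g r s = 0 := by
    intro r s hs
    by_cases h : ∃ x ∈ σ, x.pos = r
    · simp only [g, dif_pos h]
      exact theta_lower v _ (by rw [h.choose_spec.2]; exact hs)
    · simp only [g, dif_neg h]
      exact Pi.single_eq_of_ne hs.ne _
  have hdiag : ∀ r, g r r = 1 := by
    intro r
    by_cases h : ∃ x ∈ σ, x.pos = r
    · simp only [g, dif_pos h]
      have := theta_pos v h.choose
      rwa [h.choose_spec.2] at this
    · simp only [g, dif_neg h]
      exact Pi.single_eq_same _ _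
  have hdet : (Matrix.of g).det = 1 := by
    rw [Matrix.det_of_isUpperTriangular (M := Matrix.of g) (fun r s h => hlow r s h)]
    exact Finset.prod_eq_one fun r _ => hdiag r
  have hunit : IsUnit (Matrix.of g).det := by rw [hdet]; exact isUnit_one
  have hw : (Matrix.of g).mulVec ((Matrix.of g)⁻¹.mulVec (stdVec F p)) = stdVec F p := by
    rw [Matrix.mulVec_mulVec, Matrix.mul_nonsing_inv _ hunit, Matrix.one_mulVec]
  refine ⟨(Matrix.of g)⁻¹.mulVec (stdVec F p), fun h0 => ?_, fun x hx => ?_⟩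
  · rw [h0, Matrix.mulVec_zero] at hw
    have := congrFun hw p
    simp [stdVec] at this
  · have h := congrFun hw x.pos
    have h2 : (Matrix.of g).mulVec ((Matrix.of g)⁻¹.mulVec (stdVec F p)) x.pos
        = g x.pos ⬝ᵥ ((Matrix.of g)⁻¹.mulVec (stdVec F p)) := rfl
    rw [h2, hg x hx] at h
    rw [dotProduct_comm, h, stdVec, Pi.single_apply]

theorem pos_injOn {σ : Finset (Vertex m)} (hσ : σ ∈ (coneComplex m).faces) :
    Set.InjOn Vertex.pos (σ : Set (Vertex m)) := by
  have hoct : ∀ τ ∈ (octahedron m).faces, ∀ i ε δ, Vertex.a i ε ∈ τ → Vertex.a i δ ∈ τ → ε = δ := by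
    intro τ hτ i ε δ h1 h2
    cases ε <;> cases δ
    · rfl
    · exact (hτ.2 i ⟨h1, h2⟩).elim
    · exact (hτ.2 i ⟨h2, h1⟩).elim
    · rfl
  have hk : ∀ i ε δ, Vertex.a i ε ∈ σ → Vertex.a i δ ∈ σ → ε = δ := by
    rcases hσ with h | ⟨τ, h, -, (rfl | rfl)⟩
    · exact hoct σ h
    · exact hoct σ h
    · intro i ε δ h1 h2
      refine hoct τ h i ε δ ?_ ?_
      · exact (Finset.mem_insert.1 h1).resolve_left (by simp)
      · exact (Finset.mem_insert.1 h2).resolve_left (by simp)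
  intro x hx y hy hxy
  cases x with
  | a i ε =>
    cases y with
    | a j δ =>
      have e : i = j := Fin.castSucc_injective m hxy
      subst e
      rw [hk i ε δ hx hy]
    | b => exact ((Fin.castSucc_lt_last i).ne hxy).elim
  | b =>
    cases y with
    | a j δ => exact ((Fin.castSucc_lt_last j).ne hxy.symm).elim
    | b => rfl

theorem exists_pos_not_mem {σ : Finset (Vertex m)} (hσ : σ ∈ (coneComplex m).faces) :
    ∃ p, ∀ x ∈ σ, Vertex.pos x ≠ p := by
  by_contra hcon
  push Not at hcon
  have himg : σ.image Vertex.pos = Finset.univ := by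
    ext p
    obtain ⟨x, hx, hxp⟩ := hcon p
    simp only [Finset.mem_image, Finset.mem_univ, iff_true]
    exact ⟨x, hx, hxp⟩
  have hcard : m + 1 ≤ σ.card := by
    have := Finset.card_image_le (s := σ) (f := Vertex.pos)
    rw [himg, Finset.card_univ, Fintype.card_fin] at this
    exact this
  have hoct : Vertex.b ∉ σ → False := by
    intro hb
    obtain ⟨x, hx, hxp⟩ := hcon (Fin.last m)
    cases x with
    | a i ε => exact (Fin.castSucc_lt_last i).ne hxp
    | b => exact hb hx
  rcases hσ with h | ⟨τ, h, hc, (rfl | rfl)⟩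
  · exact hoct h.1
  · exact hoct h.1
  · have := Finset.card_insert_le Vertex.b τ
    omega

/-- The subspace `⟨θ(x) : x ∈ σ⟩^⊥`. -/
def perpTheta (v : IndexT F m) (σ : Finset (Vertex m)) : Submodule F (Fin (m + 1) → F) :=
  perp (Submodule.span F (theta v '' (σ : Set (Vertex m))) : Set (Fin (m + 1) → F))

theorem mem_perpTheta (v : IndexT F m) (σ : Finset (Vertex m)) (u : Fin (m + 1) → F) :
    u ∈ perpTheta v σ ↔ ∀ x ∈ σ, u ⬝ᵥ theta v x = 0 := by
  constructor
  · intro h x hx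
    exact h _ (Submodule.subset_span ⟨x, hx, rfl⟩)
  · intro h s hs
    have hle : Submodule.span F (theta v '' (σ : Set (Vertex m)))
        ≤ LinearMap.ker (dotProductBilin F F u) := by
      rw [Submodule.span_le]
      rintro _ ⟨x, hx, rfl⟩
      exact h x hx
    exact hle hs

theorem perpTheta_ne (v : IndexT F m) {σ : Finset (Vertex m)} (hσ : σ ∈ (coneComplex m).faces)
    (hne : σ.Nonempty) : perpTheta v σ ≠ ⊥ ∧ perpTheta v σ ≠ ⊤ := by
  constructor
  · obtain ⟨p, hp⟩ := exists_pos_not_mem hσ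
    obtain ⟨w, hw0, hw⟩ := exists_dual v (pos_injOn hσ) p
    intro h
    have hm : w ∈ perpTheta v σ := (mem_perpTheta v σ w).2 fun x hx => by
      rw [hw x hx, if_neg (hp x hx)]
    rw [h] at hm
    exact hw0 ((Submodule.mem_bot F).1 hm)
  · obtain ⟨x, hx⟩ := hne
    obtain ⟨w, -, hw⟩ := exists_dual v (pos_injOn hσ) x.pos
    intro h
    have hm : w ∈ perpTheta v σ := h ▸ Submodule.mem_top
    have h0 := (mem_perpTheta v σ w).1 hm x hx
    rw [hw x hx, if_pos rfl] at h0
    exact one_ne_zero h0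

theorem perpTheta_lt (v : IndexT F m) {σ τ : Finset (Vertex m)}
    (hτ : τ ∈ (coneComplex m).faces) (h : σ ⊂ τ) : perpTheta v τ < perpTheta v σ := by
  rw [Finset.ssubset_iff_exists_cons_subset] at h
  obtain ⟨x, hxσ, hsub⟩ := h
  have hxτ : x ∈ τ := hsub (Finset.mem_cons_self x σ)
  have hστ : σ ⊆ τ := fun y hy => hsub (Finset.mem_cons_of_mem hy)
  obtain ⟨w, -, hw⟩ := exists_dual v (pos_injOn hτ) x.pos
  refine lt_of_le_of_ne (fun u hu => ?_) fun heq => ?_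
  · rw [mem_perpTheta] at hu ⊢
    exact fun y hy => hu y (hστ hy)
  · have hm : w ∈ perpTheta v σ := (mem_perpTheta v σ w).2 fun y hy => by
      rw [hw y (hστ hy), if_neg]
      intro e
      exact hxσ (pos_injOn hτ (hστ hy) hxτ e ▸ hy)
    rw [← heq] at hm
    have h0 := (mem_perpTheta v τ w).1 hm x hxτ
    rw [hw x hxτ, if_pos rfl] at h0
    exact one_ne_zero h0

/-- The vertex map `σ ↦ ⟨θ(x) : x ∈ σ⟩^⊥`. -/
def fVertex (v : IndexT F m) (σ : SdVertex (coneComplex m)) : ProperSubspace F m :=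
  ⟨perpTheta v σ.1, perpTheta_ne v σ.2.1 σ.2.2⟩

theorem fVertex_lt (v : IndexT F m) {σ τ : SdVertex (coneComplex m)} (h : σ < τ) :
    fVertex v σ < fVertex v τ := by
  have h' : τ.1 ⊂ σ.1 := h
  exact perpTheta_lt v σ.2.1 h'

/-- The simplicial map `f_v : sd(K) → X_V`. -/
def fMap (v : IndexT F m) : OrderedMap (sd (coneComplex m)) (building F m) where
  toFun := fVertex v
  map_faces := by
    intro σ hσ s hs t ht _
    obtain ⟨i, hi, rfl⟩ := Finset.mem_image.1 (Finset.mem_coe.1 hs)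
    obtain ⟨j, hj, rfl⟩ := Finset.mem_image.1 (Finset.mem_coe.1 ht)
    have hmono : Monotone (fVertex v) := by
      intro a b hab
      rcases hab.eq_or_lt with rfl | h
      · exact le_rfl
      · exact (fVertex_lt v h).le
    rcases hσ.total hi hj with h | h
    · exact Or.inl (hmono h)
    · exact Or.inr (hmono h)
  map_lt := fun _ _ _ _ _ _ h => fVertex_lt v h

/-- The local system `𝔥_v = f_v⁻¹ 𝔤` on `sd(K)`. -/
abbrev hSystem (v : IndexT F m) : LocalSystem F (sd (coneComplex m)) := (fMap v).pullback (taut F m)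

/-- The sequence `v^ε`, with entries `e_i` where `ε_i = 0` and `v_i` where `ε_i = 1`. -/
def seqV (v : IndexT F m) (ε : Fin m → Bool) (i : Fin m) : Fin (m + 1) → F :=
  if ε i then v.1 i else stdVec F i.castSucc

/-- `w(u)`, the element `w` of `⟨u_1, …, u_{n-1}⟩^⊥` with `w · e_n = 1`. It exists and is unique
if `u_1, …, u_{n-1}, e_n` are linearly independent; `w(u) = 0` if there is no such element. -/
def wVec (u : Fin m → (Fin (m + 1) → F)) : Fin (m + 1) → F :=
  if h : ∃ w ∈ perp (Submodule.span F (Set.range u) : Set (Fin (m + 1) → F)),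
      w ⬝ᵥ stdVec F (Fin.last m) = 1
  then h.choose else 0

theorem theta_seqA (v : IndexT F m) (ε : Fin m → Bool) (i : Fin m) :
    theta v (seqA ε i) = seqV v ε i := by
  unfold seqA seqV
  cases h : ε i <;> simp [theta]

theorem wVec_seqV (v : IndexT F m) (ε : Fin m → Bool) :
    (∀ i, wVec (seqV v ε) ⬝ᵥ seqV v ε i = 0) ∧
      wVec (seqV v ε) ⬝ᵥ stdVec F (Fin.last m) = 1 := by
  have hex : ∃ w ∈ perp (Submodule.span F (Set.range (seqV v ε)) : Set (Fin (m + 1) → F)),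
      w ⬝ᵥ stdVec F (Fin.last m) = 1 := by
    have hinj : Set.InjOn Vertex.pos
        ((insert Vertex.b (Finset.univ.image (seqA ε)) : Finset (Vertex m)) : Set (Vertex m)) := by
      intro x hx y hy hxy
      simp only [Finset.coe_insert, Finset.coe_image, Finset.coe_univ, Set.image_univ,
        Set.mem_insert_iff, Set.mem_range] at hx hy
      rcases hx with rfl | ⟨i, rfl⟩ <;> rcases hy with rfl | ⟨j, rfl⟩
      · rfl
      · exact ((Fin.castSucc_lt_last j).ne hxy.symm).elim
      · exact ((Fin.castSucc_lt_last i).ne hxy).elim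
      · rw [Fin.castSucc_injective m hxy]
    obtain ⟨w, -, hw⟩ := exists_dual v hinj (Fin.last m)
    refine ⟨w, ?_, ?_⟩
    · have hle : Submodule.span F (Set.range (seqV v ε))
          ≤ LinearMap.ker (dotProductBilin F F w) := by
        rw [Submodule.span_le]
        rintro _ ⟨i, rfl⟩
        have := hw (seqA ε i)
          (Finset.mem_insert_of_mem (Finset.mem_image_of_mem _ (Finset.mem_univ i)))
        rw [theta_seqA, if_neg] at this
        · exact this
        · exact (Fin.castSucc_lt_last i).ne
      exact fun s hs => hle hs
    · have := hw Vertex.b (Finset.mem_insert_self _ _)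
      rw [if_pos (show Vertex.b.pos = Fin.last m from rfl)] at this
      exact this
  have e : wVec (seqV v ε) = hex.choose := dif_pos hex
  rw [e]
  exact ⟨fun i => hex.choose_spec.1 _ (Submodule.subset_span ⟨i, rfl⟩), hex.choose_spec.2⟩

/-- The sign `χ(ε, π) = (-1)^{ε_1 + ⋯ + ε_{n-1}} sgn(π)`. -/
def chi (ε : Fin m → Bool) (π : Equiv.Perm (Fin m)) : ℤ :=
  (-1) ^ (Finset.univ.filter fun i => ε i = true).card * (Equiv.Perm.sign π : ℤ)

theorem mem_bottom_flag (v : IndexT F m) (x : Fin m → Vertex m)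
    (hx : Finset.univ.image x ∈ (coneComplex m).faces) (hinj : Function.Injective x)
    (w : Fin (m + 1) → F) (hw : ∀ i, w ⬝ᵥ theta v (x i) = 0) :
    w ∈ bottom ((fMap v).mapFace (flagSimplex x hx hinj).1).1 := by
  intro U hU
  obtain ⟨s, hs, rfl⟩ := Finset.mem_image.1 hU
  obtain ⟨i, -, rfl⟩ := Finset.mem_image.1 hs
  refine (mem_perpTheta v _ w).2 fun y hy => ?_
  obtain ⟨j, -, rfl⟩ := Finset.mem_image.1 hy
  exact hw j

theorem coeffAB_dot (v : IndexT F m) (j : Fin m) (ε : Fin m → Bool) (i : Fin m) :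
    (wVec (seqV v (Function.update ε j true)) - wVec (seqV v ε)) ⬝ᵥ theta v (seqAB ε j i) = 0 := by
  rw [sub_dotProduct, sub_eq_zero]
  by_cases h : i = j
  · have e : theta v (seqAB ε j i) = stdVec F (Fin.last m) := by simp [seqAB, h, theta]
    rw [e, (wVec_seqV v _).2, (wVec_seqV v _).2]
  · have e1 : theta v (seqAB ε j i) = seqV v ε i := by
      rw [← theta_seqA]; simp [seqAB, seqA, h]
    have e2 : seqV v ε i = seqV v (Function.update ε j true) i := by simp [seqV, h]
    rw [e1, (wVec_seqV v ε).1 i, e2, (wVec_seqV v _).1 i]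

/-- `w(v^ε)` as an element of `𝔥_v(S(π(a^ε)))`. -/
def coeffA (v : IndexT F m) (ε : Fin m → Bool) (π : Equiv.Perm (Fin m)) :
    (hSystem v).obj
      (flagSimplex (seqA ε ∘ π) (seqA_mem ε π) ((seqA_injective ε).comp π.injective)).1 :=
  ⟨wVec (seqV v ε), by
  exact mem_bottom_flag v _ _ _ _ fun i => by
      rw [Function.comp_apply, theta_seqA]; exact (wVec_seqV v ε).1 _⟩

/-- `w(v^{ε + e_j}) - w(v^ε)` as an element of `𝔥_v(S(π(a^{ε,j})))`, where `ε_j = 0`. -/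
def coeffAB (v : IndexT F m) (j : Fin m) (ε : Fin m → Bool) (π : Equiv.Perm (Fin m)) :
    (hSystem v).obj
      (flagSimplex (seqAB ε j ∘ π) (seqAB_mem ε j π)
        ((seqAB_injective ε j).comp π.injective)).1 :=
  ⟨wVec (seqV v (Function.update ε j true)) - wVec (seqV v ε), by
    exact mem_bottom_flag v _ _ _ _ fun i => coeffAB_dot v j ε _⟩

/-- The chain `c_v` on `sd(K)` of degree `n - 2`.  The simplices `S(π(a^ε))` and `S(π(a^{ε,j}))`
(with `ε_j = 0`) are pairwise distinct, so the summands are the values of `c_v` on them. -/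
def cChain (v : IndexT F m) : (hSystem v).Chain m :=
  (∑ ε : Fin m → Bool, ∑ π : Equiv.Perm (Fin m),
    chi ε π • (hSystem v).single
      (flagSimplex (seqA ε ∘ π) (seqA_mem ε π) ((seqA_injective ε).comp π.injective))
      (coeffA v ε π)) +
  ∑ j : Fin m, ∑ ε : Fin m → Bool with ε j = false, ∑ π : Equiv.Perm (Fin m),
    chi ε π • (hSystem v).single
      (flagSimplex (seqAB ε j ∘ π) (seqAB_mem ε j π) ((seqAB_injective ε j).comp π.injective))
      (coeffAB v j ε π)

end TwistedBuilding

end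

noncomputable section

/-! There are no simplices above dimension n - 2 in the building, so `D1` is the space of
top-dimensional cycles, and a cycle is a function on complete flags whose value lies in the line of
the flag. Call a flag a base flag if it has the form ⟨v₁⟩^⊥ ⊃ ⟨v₁, v₂⟩^⊥ ⊃ ⋯ with v in the index
set. Its line is orthogonal to all v_i. Since v₁, …, v_{n-1}, e_n is unitriangular, a vector of this
line is determined by its last coordinate. Reading off last coordinates at all base flags, with a
sign, gives a linear map from cycles to functions on the index set (`baseCoords`, `homologyCoords`).
The theorem follows once this map is shown to be injective and to send the class of c_v to the
indicator function of v.

The c_v are cycles (`cChain_mem_cycles`). Faces of S(π(x)) that omit a prefix other than the full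
one cancel under an adjacent transposition of π. Omitting the full prefix forgets the last entry.
There the first differences of w on the octahedron cancel against the simplices with b in last
place, and the remaining terms carry second differences of w, which are symmetric in two directions
while the sign is antisymmetric (`sum_last_face_eq_zero`).

Injectivity (`eq_zero_of_generic`, `cycle_eq_zero`) is an induction on dimension. If U has
coordinate functionals e, e', … and f is the dual vector of e, then a hyperplane of U other than e^⊥
which avoids f is cut out by some v ∈ e + ⟨e', …⟩, and the induction hypothesis applies inside it.
Hyperplanes through f are handled by the induction hypothesis for another list of functionals,
together with the cycle condition at a codimension-two subspace. The cycle condition then disposes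
of e^⊥. In dimension two the twisting is essential: values in two distinct lines can add up to zero
only if both are zero.

The image of the class of c_v is an indicator (`coeff_chainMap_cChain`) because, among the flags
f_v(S(x)), the base flag of u occurs only for x = a^{(1,…,1)} in its natural order, and only when u
= v (`eq_of_mapSimplex_eq_baseFlag`). This uses triangularity and the condition u_i ≠ e_i. -/

namespace TwistedBuilding

open scoped Classical DirectSum

/-! ### Twisted chains as vector-valued functions on vertex sets -/

namespace LocalSystem

variable {S R M : Type*} [Ring R] [AddCommGroup M] [Module R M] {X : OrderedCpx S}
  (A : LocalSystem R X) (φ : ∀ σ : X.faces, A.obj σ →ₗ[R] M)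

/-- Twisted chains viewed as finitely supported functions on finite vertex sets, by means of maps
from the values of the local system to a fixed module. -/
def toFinsupp (k : ℕ) : A.Chain k →ₗ[R] Finset S →₀ M :=
  DirectSum.toModule R (X.Simplex k) _ fun σ => Finsupp.lsingle σ.1.1 ∘ₗ φ σ.1

theorem toFinsupp_single {k : ℕ} (σ : X.Simplex k) (x : A.obj σ.1) :
    A.toFinsupp φ k (A.single σ x) = Finsupp.single σ.1.1 (φ σ.1 x) := by
  rw [toFinsupp, single, DirectSum.toModule_lof]
  rfl

theorem toFinsupp_apply {k : ℕ} (c : A.Chain k) (σ : X.Simplex k) :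
    A.toFinsupp φ k c σ.1.1 = φ σ.1 (c σ) := by
  induction c using DirectSum.induction_on with
  | zero => simp
  | add a b ha hb => simp [ha, hb]
  | of τ x =>
    have h := A.toFinsupp_single φ τ x
    change A.toFinsupp φ k (DirectSum.of _ τ x) = _ at h
    rw [h]
    by_cases e : τ = σ
    · subst e
      simp
    · rw [Finsupp.single_eq_of_ne, DirectSum.of_eq_of_ne _ _ _ (Ne.symm e), map_zero]
      exact fun h => e (OrderedCpx.Simplex.ext (Subtype.ext h.symm))

theorem toFinsupp_apply_of_not {k : ℕ} (c : A.Chain k) (s : Finset S)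
    (hs : ¬ (s ∈ X.faces ∧ s.card = k)) : A.toFinsupp φ k c s = 0 := by
  induction c using DirectSum.induction_on with
  | zero => simp
  | add a b ha hb => simp [ha, hb]
  | of τ x =>
    have h := A.toFinsupp_single φ τ x
    change A.toFinsupp φ k (DirectSum.of _ τ x) = _ at h
    rw [h, Finsupp.single_eq_of_ne]
    rintro rfl
    exact hs ⟨τ.1.2, τ.2⟩

theorem toFinsupp_injective (hφ : ∀ σ, Function.Injective (φ σ)) (k : ℕ) :
    Function.Injective (A.toFinsupp φ k) := by
  intro c d h
  refine DFinsupp.ext fun σ => hφ _ ?_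
  rw [← toFinsupp_apply, ← toFinsupp_apply, h]

/-- The sign of the vertex `s` in the finite vertex set `t`. -/
def vertexSign (X : OrderedCpx S) (t : Finset S) (s : S) : ℤ :=
  (-1) ^ (t.filter fun r => X.lt r s).card

/-- The condition `hres` says that the maps `φ` turn all connecting maps into the identity of `M`,
so the boundary takes the form it has for constant coefficients, and no transport between different
modules is needed. -/
theorem toFinsupp_boundary_single
    (hres : ∀ {σ τ : X.faces} (h : σ.1 ⊆ τ.1) (x : A.obj τ), φ σ (A.res h x) = φ τ x)
    {k : ℕ} (σ : X.Simplex (k + 1)) (x : A.obj σ.1) :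
    A.toFinsupp φ k (A.boundary k (A.single σ x)) =
      ∑ s ∈ σ.1.1, vertexSign X σ.1.1 s • Finsupp.single (σ.1.1.erase s) (φ σ.1 x) := by
  rw [boundary_single, map_sum]
  refine Eq.trans ?_ (Finset.sum_coe_sort σ.1.1 fun s =>
    vertexSign X σ.1.1 s • Finsupp.single (σ.1.1.erase s) (φ σ.1 x))
  refine Finset.sum_congr rfl fun s _ => ?_
  rw [map_zsmul, toFinsupp_single]
  exact congrArg (fun y => σ.sgn s • Finsupp.single (σ.1.1.erase s.1) y)
    (hres (σ := (σ.face s).1) (Finset.erase_subset s.1 σ.1.1) x)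

/-- The coefficient of a boundary at a simplex. -/
theorem toFinsupp_boundary_apply [Fintype S]
    (hres : ∀ {σ τ : X.faces} (h : σ.1 ⊆ τ.1) (x : A.obj τ), φ σ (A.res h x) = φ τ x)
    {k : ℕ} (c : A.Chain (k + 1)) (t : Finset S) :
    A.toFinsupp φ k (A.boundary k c) t =
      ∑ s : S with s ∉ t, vertexSign X (insert s t) s • A.toFinsupp φ (k + 1) c (insert s t) := by
  induction c using DirectSum.induction_on with
  | zero => simp
  | add a b ha hb => simp [ha, hb, Finset.sum_add_distrib]
  | of τ x =>
    change A.toFinsupp φ k (A.boundary k (A.single τ x)) t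
      = ∑ s : S with s ∉ t, vertexSign X (insert s t) s •
        A.toFinsupp φ (k + 1) (A.single τ x) (insert s t)
    rw [toFinsupp_boundary_single A φ hres, toFinsupp_single, Finsupp.finsetSum_apply]
    -- The nonzero terms on both sides belong to the same vertices: removing s from τ gives t
    -- exactly when s ∈ τ, s ∉ t and inserting s into t gives τ.
    refine Finset.sum_bij_ne_zero (fun s _ _ => s) ?_ (fun _ _ _ _ _ _ h => h) ?_ ?_
    · intro s hs h0
      simp only [Finsupp.smul_apply, Finsupp.single_apply] at h0
      split_ifs at h0 with h
      · simp [← h]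
      · simp at h0
    · intro s hs h0
      simp only [Finsupp.single_apply] at h0
      split_ifs at h0 with h
      · refine ⟨s, by simp [h], ?_, rfl⟩
        rw [h]
        simpa [Finset.erase_insert (Finset.mem_filter.1 hs).2] using h0
      · simp at h0
    · intro s hs h0
      simp only [Finsupp.smul_apply, Finsupp.single_apply] at h0
      split_ifs at h0 with h
      · simp [← h, Finset.insert_erase hs]
      · simp at h0

end LocalSystem

/-! ### The chains `c_v` are cycles -/

section Signs

variable {k : ℕ} {N M : Type*} [AddCommGroup N] [AddCommGroup M]

theorem sum_bool_eq_sum_filter (p : Fin k) (f : (Fin k → Bool) → N) :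
    ∑ ε : Fin k → Bool, f ε =
      ∑ ε : Fin k → Bool with ε p = false, (f ε + f (Function.update ε p true)) := by
  rw [← Finset.sum_filter_add_sum_filter_not Finset.univ (fun ε : Fin k → Bool => ε p = false),
    Finset.sum_add_distrib]
  congr 1
  symm
  refine Finset.sum_bij' (fun ε _ => Function.update ε p true)
    (fun ε _ => Function.update ε p false) ?_ ?_ ?_ ?_ ?_
  · intro ε _; simp
  · intro ε _; simp
  · intro ε h
    have : ε p = false := by simpa using h
    simp [← this]
  · intro ε h
    have : ε p = true := by simpa using h
    simp [← this]
  · intro ε _; rfl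

theorem chi_update (ε : Fin k → Bool) (π : Equiv.Perm (Fin k)) (p : Fin k) (h : ε p = false) :
    chi (Function.update ε p true) π = -chi ε π := by
  have e : (Finset.univ.filter fun i => Function.update ε p true i = true)
      = insert p (Finset.univ.filter fun i => ε i = true) := by
    ext i
    by_cases hi : i = p
    · simp [hi]
    · simp [hi]
  rw [chi, chi, e, Finset.card_insert_of_notMem (by simp [h])]
  ring

theorem chi_mul_swap (ε : Fin k → Bool) (π : Equiv.Perm (Fin k)) {i j : Fin k} (h : i ≠ j) :
    chi ε (π * Equiv.swap i j) = -chi ε π := by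
  simp [chi, Equiv.Perm.sign_mul, Equiv.Perm.sign_swap h]

theorem chi_swap_mul (ε : Fin k → Bool) (π : Equiv.Perm (Fin k)) {i j : Fin k} (h : i ≠ j) :
    chi ε (Equiv.swap i j * π) = -chi ε π := by
  simp [chi, Equiv.Perm.sign_mul, Equiv.Perm.sign_swap h]

/-- Cancellation of the codimension one faces obtained by omitting the largest simplex of `K`
from a flag. -/
theorem sum_last_face_eq_zero (E : (Fin (k + 1) → Vertex (k + 1)) → M →+ N)
    (hE : ∀ x x', (∀ i, i ≠ Fin.last k → x i = x' i) → E x = E x')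
    (w : (Fin (k + 1) → Bool) → M) :
    ∑ π : Equiv.Perm (Fin (k + 1)), ∑ ε : Fin (k + 1) → Bool, chi ε π • E (seqA ε ∘ π) (w ε) +
      ∑ π : Equiv.Perm (Fin (k + 1)), ∑ j : Fin (k + 1), ∑ ε : Fin (k + 1) → Bool with ε j = false,
        chi ε π • E (seqAB ε j ∘ π) (w (Function.update ε j true) - w ε) = 0 := by
  -- Write l = π(last). The facets a^ε and a^{ε + e_l} share the face omitting entry l, and their
  -- opposite signs leave minus the difference of w in direction l. This is the negative of the
  -- contribution of the simplex with b in place of entry l.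
  have hA : ∀ π : Equiv.Perm (Fin (k + 1)),
      ∑ ε : Fin (k + 1) → Bool, chi ε π • E (seqA ε ∘ π) (w ε) =
        -∑ ε : Fin (k + 1) → Bool with ε (π (Fin.last k)) = false,
          chi ε π • E (seqAB ε (π (Fin.last k)) ∘ π)
            (w (Function.update ε (π (Fin.last k)) true) - w ε) := by
    intro π
    rw [sum_bool_eq_sum_filter (π (Fin.last k)), ← Finset.sum_neg_distrib]
    refine Finset.sum_congr rfl fun ε hε => ?_
    have h0 : ε (π (Fin.last k)) = false := by simpa using hε
    rw [chi_update _ _ _ h0,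
      hE (seqA (Function.update ε (π (Fin.last k)) true) ∘ π) (seqAB ε (π (Fin.last k)) ∘ π)
        (fun i hi => by simp [seqA, seqAB, hi]),
      hE (seqA ε ∘ π) (seqAB ε (π (Fin.last k)) ∘ π)
        (fun i hi => by simp [seqA, seqAB, hi]), map_sub, smul_sub, neg_smul]
    abel
  -- The second difference of w in the directions j and l. It appears when b replaces entry j and a
  -- different entry l is forgotten, after pairing ε with ε + e_l.
  let D : (Fin (k + 1) → Bool) → Fin (k + 1) → Fin (k + 1) → M := fun ε j l =>
    (w (Function.update ε j true) - w ε) - (w (Function.update (Function.update ε l true) j true)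
      - w (Function.update ε l true))
  let T : Equiv.Perm (Fin (k + 1)) × Fin (k + 1) → N := fun P =>
    ∑ ε : Fin (k + 1) → Bool with ε P.2 = false ∧ ε (P.1 (Fin.last k)) = false,
      chi ε P.1 • E (seqAB ε P.2 ∘ P.1) (D ε P.2 (P.1 (Fin.last k)))
  have hB : ∀ (π : Equiv.Perm (Fin (k + 1))) (j : Fin (k + 1)), j ≠ π (Fin.last k) →
      ∑ ε : Fin (k + 1) → Bool with ε j = false,
        chi ε π • E (seqAB ε j ∘ π) (w (Function.update ε j true) - w ε) = T (π, j) := by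
    intro π j hj
    rw [Finset.sum_filter, sum_bool_eq_sum_filter (π (Fin.last k)), Finset.sum_filter]
    simp only [T]
    rw [Finset.sum_filter]
    refine Finset.sum_congr rfl fun ε _ => ?_
    by_cases h1 : ε (π (Fin.last k)) = false
    · by_cases h2 : ε j = false
      · rw [if_pos h1, if_pos h2, if_pos (by simp [hj, h2]), if_pos ⟨h2, h1⟩, chi_update _ _ _ h1,
          hE (seqAB (Function.update ε (π (Fin.last k)) true) j ∘ π) (seqAB ε j ∘ π)
            (fun i hi => by simp [seqAB, hi])]
        simp only [D]
        rw [map_sub _ (w (Function.update ε j true) - w ε), smul_sub, neg_smul, ← sub_eq_add_neg]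
      · rw [if_pos h1, if_neg h2, if_neg (by simpa [hj] using h2), if_neg (fun h => h2 h.1),
          add_zero]
    · rw [if_neg h1, if_neg (fun h => h1 h.2)]
  -- The involution exchanges the entry replaced by b with the forgotten entry. It preserves the
  -- face and the symmetric coefficient `D`, and reverses the sign of the permutation.
  have hT : ∑ P : Equiv.Perm (Fin (k + 1)) × Fin (k + 1) with P.2 ≠ P.1 (Fin.last k), T P = 0 := by
    refine Finset.sum_involution
      (fun P _ => (Equiv.swap P.2 (P.1 (Fin.last k)) * P.1, P.1 (Fin.last k))) ?_ ?_ ?_ ?_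
    · rintro ⟨π, j⟩ h
      have hj : j ≠ π (Fin.last k) := by simpa using h
      simp only [T]
      rw [show (Equiv.swap j (π (Fin.last k)) * π) (Fin.last k) = j by simp,
        show (Finset.univ.filter fun ε : Fin (k + 1) → Bool =>
          ε (π (Fin.last k)) = false ∧ ε j = false) = Finset.univ.filter fun ε =>
            ε j = false ∧ ε (π (Fin.last k)) = false from
          Finset.filter_congr fun _ _ => and_comm, ← Finset.sum_add_distrib]
      refine Finset.sum_eq_zero fun ε _ => ?_
      have e1 : D ε (π (Fin.last k)) j = D ε j (π (Fin.last k)) := by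
        simp only [D]
        rw [Function.update_comm hj]
        abel
      have e2 : E (seqAB ε (π (Fin.last k)) ∘
          ⇑(Equiv.swap j (π (Fin.last k)) * π : Equiv.Perm (Fin (k + 1)))) = E (seqAB ε j ∘ π) := by
        refine hE _ _ fun i hi => ?_
        have hi' : π i ≠ π (Fin.last k) := fun h => hi (π.injective h)
        by_cases hij : π i = j
        · simp [seqAB, hij]
        · simp [seqAB, hij, Equiv.swap_apply_of_ne_of_ne hij hi', hi']
      rw [e1, e2, chi_swap_mul _ _ hj, neg_smul, add_neg_cancel]
    · rintro ⟨π, j⟩ h _ he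
      have hj : j ≠ π (Fin.last k) := by simpa using h
      exact hj (congrArg Prod.snd he).symm
    · rintro ⟨π, j⟩ h
      have hj : j ≠ π (Fin.last k) := by simpa using h
      simpa using hj.symm
    · rintro ⟨π, j⟩ h
      ext1
      · simp [Equiv.swap_comm, ← mul_assoc]
      · simp
  rw [← Finset.sum_add_distrib, ← hT, Finset.sum_filter, Fintype.sum_prod_type]
  refine Finset.sum_congr rfl fun π _ => ?_
  rw [hA, ← Finset.add_sum_erase Finset.univ _ (Finset.mem_univ (π (Fin.last k))),
    neg_add_cancel_left, ← Finset.add_sum_erase Finset.univ _ (Finset.mem_univ (π (Fin.last k))),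
    if_neg (by simp), zero_add]
  refine Finset.sum_congr rfl fun j hj => ?_
  have hj' := Finset.ne_of_mem_erase hj
  rw [if_pos hj', hB π j hj']

end Signs

/-! ### Faces of the simplices S(x) and their cancellation -/

/-- The prefixes of the sequence `x`, with the `i`-th one omitted. -/
def prefixFace {S : Type*} {k : ℕ} (x : Fin k → S) (i : Fin k) : Finset (Finset S) :=
  (Finset.univ.erase i).image fun r => (Finset.Iic r).image x

/-- Only the full prefix contains the last entry. This supplies the hypothesis `hE` of
`sum_last_face_eq_zero`. -/
theorem prefixFace_congr {S : Type*} {k : ℕ} {x y : Fin (k + 1) → S}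
    (h : ∀ i, i ≠ Fin.last k → x i = y i) :
    prefixFace x (Fin.last k) = prefixFace y (Fin.last k) := by
  refine Finset.image_congr fun r hr => Finset.image_congr fun s hs => h s ?_
  have h1 : r ≠ Fin.last k := Finset.ne_of_mem_erase (Finset.mem_coe.1 hr)
  have h2 : s ≤ r := by simpa using hs
  exact (h2.trans_lt (Fin.lt_last_iff_ne_last.2 h1)).ne

/-- Exchanging two consecutive entries changes only the prefix ending between them, and that is the
omitted one. -/
theorem prefixFace_comp_swap {S : Type*} {k : ℕ} (x : Fin (k + 1) → S) (i : Fin k) :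
    prefixFace (x ∘ Equiv.swap i.castSucc i.succ) i.castSucc = prefixFace x i.castSucc := by
  refine Finset.image_congr fun r hr => ?_
  have h1 : r ≠ i.castSucc := Finset.ne_of_mem_erase (Finset.mem_coe.1 hr)
  have hmem : ∀ s, s ≤ r → Equiv.swap i.castSucc i.succ s ≤ r := by
    intro s hs
    rcases eq_or_ne s i.castSucc with rfl | hs1
    · rw [Equiv.swap_apply_left, Fin.le_def, Fin.val_succ]
      have := lt_of_le_of_ne hs h1.symm
      rw [Fin.lt_def, Fin.val_castSucc] at this
      omega
    · rcases eq_or_ne s i.succ with rfl | hs2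
      · rw [Equiv.swap_apply_right]
        exact (Fin.castSucc_lt_succ (i := i)).le.trans hs
      · rwa [Equiv.swap_apply_of_ne_of_ne hs1 hs2]
  ext y
  simp only [Finset.mem_image, Finset.mem_Iic, Function.comp_apply]
  constructor
  · rintro ⟨s, hs, rfl⟩
    exact ⟨_, hmem s hs, rfl⟩
  · rintro ⟨s, hs, rfl⟩
    exact ⟨_, hmem s hs, by rw [Equiv.swap_apply_self]⟩

theorem sum_inner_face_eq_zero {S M : Type*} [AddCommGroup M] {k : ℕ} (x : Fin (k + 1) → S)
    (ε : Fin (k + 1) → Bool) (i : Fin k) (y : M) :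
    ∑ π : Equiv.Perm (Fin (k + 1)),
      chi ε π • Finsupp.single (prefixFace (x ∘ π) i.castSucc) y = 0 := by
  have hne : i.castSucc ≠ i.succ := (Fin.castSucc_lt_succ (i := i)).ne
  refine Finset.sum_involution (fun π _ => π * Equiv.swap i.castSucc i.succ) ?_ ?_ ?_ ?_
  · intro π _
    rw [chi_mul_swap _ _ hne, Equiv.Perm.coe_mul, ← Function.comp_assoc, prefixFace_comp_swap,
      neg_smul, add_neg_cancel]
  · intro π _ _ h
    rw [mul_eq_left, Equiv.swap_eq_one_iff] at h
    exact hne h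
  · intro π _
    exact Finset.mem_univ _
  · intro π _
    rw [mul_assoc, Equiv.swap_mul_self, mul_one]

/-- The signs `s i` may be arbitrary because the cancellation happens separately for each omitted
position. -/
theorem sum_flag_faces_eq_zero {M : Type*} [AddCommGroup M] {k : ℕ}
    (w : (Fin (k + 1) → Bool) → M) (s : Fin (k + 1) → ℤ) :
    ∑ ε : Fin (k + 1) → Bool, ∑ π : Equiv.Perm (Fin (k + 1)), chi ε π •
        ∑ i, s i • Finsupp.single (prefixFace (seqA ε ∘ π) i) (w ε) +
      ∑ j : Fin (k + 1), ∑ ε : Fin (k + 1) → Bool with ε j = false,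
        ∑ π : Equiv.Perm (Fin (k + 1)), chi ε π •
          ∑ i, s i • Finsupp.single (prefixFace (seqAB ε j ∘ π) i)
            (w (Function.update ε j true) - w ε) = 0 := by
  have key : ∀ (x : Fin (k + 1) → Vertex (k + 1)) (ε : Fin (k + 1) → Bool) (y : M),
      ∑ π : Equiv.Perm (Fin (k + 1)), chi ε π •
        ∑ i, s i • Finsupp.single (prefixFace (x ∘ π) i) y =
      ∑ π : Equiv.Perm (Fin (k + 1)), chi ε π • s (Fin.last k) •
        Finsupp.single (prefixFace (x ∘ π) (Fin.last k)) y := by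
    intro x ε y
    simp only [Fin.sum_univ_castSucc, smul_add, Finset.sum_add_distrib, Finset.smul_sum]
    rw [Finset.sum_comm, add_eq_right]
    refine Finset.sum_eq_zero fun i _ => ?_
    simp only [smul_comm _ (s i.castSucc)]
    rw [← Finset.smul_sum, sum_inner_face_eq_zero, smul_zero]
  simp only [key]
  have h := sum_last_face_eq_zero
    (fun x => (s (Fin.last k)) • Finsupp.singleAddHom (M := M) (prefixFace x (Fin.last k)))
    (fun x x' hx => by rw [prefixFace_congr hx]) w
  rw [Finset.sum_comm, ← h]
  congr 1
  rw [Finset.sum_comm]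
  refine Finset.sum_congr rfl fun j _ => ?_
  rw [Finset.sum_comm]
  rfl

variable {F : Type*} [Field F] {m : ℕ}

/-- The inclusion of the values of `𝔤` into `V`. -/
def tautIncl (σ : (building F m).faces) : (taut F m).obj σ →ₗ[F] (Fin (m + 1) → F) :=
  (bottom σ.1).subtype

theorem tautIncl_injective (σ : (building F m).faces) : Function.Injective (tautIncl σ) :=
  Subtype.val_injective

theorem tautIncl_res {σ τ : (building F m).faces} (h : σ.1 ⊆ τ.1) (x : (taut F m).obj τ) :
    tautIncl σ ((taut F m).res h x) = tautIncl τ x :=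
  coe_bottomIncl h x

/-- Larger simplices come first in the subdivision, so the vertices preceding the prefix of index i
are the k - 1 - i longer prefixes. -/
theorem vertexSign_prefixVertex {S : Type*} {K : SimplicialCpx S} {k : ℕ} (x : Fin k → S)
    (hx : Finset.univ.image x ∈ K.faces) (hinj : Function.Injective x) (i : Fin k) :
    LocalSystem.vertexSign (sd K) (Finset.univ.image (prefixVertex x hx)) (prefixVertex x hx i)
      = (-1) ^ (k - 1 - i : ℕ) := by
  have : (Finset.univ.image (prefixVertex x hx)).filter
      (fun r => (sd K).lt r (prefixVertex x hx i)) = (Finset.Ioi i).image (prefixVertex x hx) := by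
    ext r
    simp only [Finset.mem_filter, Finset.mem_image, Finset.mem_univ, true_and, Finset.mem_Ioi]
    have hlt : ∀ a b, (sd K).lt (prefixVertex x hx a) (prefixVertex x hx b) ↔ b < a := by
      intro a b
      change (Finset.Iic b).image x ⊂ (Finset.Iic a).image x ↔ b < a
      rw [Finset.image_ssubset_image hinj, Finset.Iic_ssubset_Iic]
    constructor
    · rintro ⟨⟨a, rfl⟩, h⟩
      exact ⟨a, (hlt a i).1 h, rfl⟩
    · rintro ⟨a, h, rfl⟩
      exact ⟨⟨a, rfl⟩, (hlt a i).2 h⟩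
  rw [LocalSystem.vertexSign, this,
    Finset.card_image_of_injective _ (prefixVertex_injective x hx hinj), Fin.card_Ioi]

theorem flag_boundary {S R M : Type*} [Ring R] [AddCommGroup M] [Module R M] {K : SimplicialCpx S}
    (A : LocalSystem R (sd K)) (φ : ∀ σ : (sd K).faces, A.obj σ →ₗ[R] M)
    (hres : ∀ {σ τ : (sd K).faces} (h : σ.1 ⊆ τ.1) (x : A.obj τ), φ σ (A.res h x) = φ τ x)
    {k : ℕ} (x : Fin (k + 1) → S) (hx : Finset.univ.image x ∈ K.faces)
    (hinj : Function.Injective x) (y : A.obj (flagSimplex x hx hinj).1) :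
    Finsupp.mapDomain (Finset.image SdVertex.val)
        (A.toFinsupp φ k (A.boundary k (A.single (flagSimplex x hx hinj) y))) =
      ∑ i : Fin (k + 1), ((-1) ^ (k - i : ℕ) : ℤ) • Finsupp.single (prefixFace x i) (φ _ y) := by
  have hpi := prefixVertex_injective x hx hinj
  rw [A.toFinsupp_boundary_single φ hres]
  change Finsupp.mapDomain _ (∑ s ∈ Finset.univ.image (prefixVertex x hx), _) = _
  rw [Finset.sum_image (fun _ _ _ _ h => hpi h), Finsupp.mapDomain_finsetSum]
  refine Finset.sum_congr rfl fun i _ => ?_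
  have hs := vertexSign_prefixVertex x hx hinj i
  change LocalSystem.vertexSign (sd K) (flagSimplex x hx hinj).1.1 _ = _ at hs
  rw [hs, Finsupp.mapDomain_smul, Finsupp.mapDomain_single]
  congr 2
  change ((Finset.univ.image (prefixVertex x hx)).erase (prefixVertex x hx i)).image _ = _
  rw [← Finset.image_erase hpi, Finset.image_image]
  rfl

theorem cChain_mem_cycles (v : IndexT F m) : cChain v ∈ (hSystem v).cycles m := by
  cases m with
  | zero => exact Submodule.mem_top
  | succ k =>
    change (hSystem v).boundary k (cChain v) = 0
    have hv : Function.Injective (SdVertex.val (K := coneComplex (k + 1))) :=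
      fun _ _ h => SdVertex.ext h
    apply (hSystem v).toFinsupp_injective (fun σ => tautIncl ((fMap v).mapFace σ))
      (fun σ => tautIncl_injective _) k
    -- Forgetting that the vertices are simplices of K loses nothing, and turns the statement into
    -- one about bare families of prefixes.
    apply Finsupp.mapDomain_injective (Finset.image_injective hv)
    have hflag := flag_boundary (hSystem v) (fun σ => tautIncl ((fMap v).mapFace σ))
      (fun h x => tautIncl_res (Finset.image_subset_image h) x) (k := k)
    rw [map_zero, Finsupp.mapDomain_zero, cChain]
    simp only [map_add, map_sum, map_zsmul, Finsupp.mapDomain_add, Finsupp.mapDomain_finsetSum,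
      Finsupp.mapDomain_smul, hflag]
    exact sum_flag_faces_eq_zero (fun ε => wVec (seqV v ε)) fun i => (-1) ^ (k - i : ℕ)

/-! ### A cycle vanishing on all generic flags is zero -/

section Vanishing

variable {F : Type*} [Field F] {N : ℕ}

/-- `A` is a subspace of `U` of codimension one. -/
def IsHyperplane (A U : Submodule F (Fin N → F)) : Prop :=
  A ≤ U ∧ Module.finrank F A + 1 = Module.finrank F U

/-- The vectors of `U` orthogonal to `v`. -/
def cut (U : Submodule F (Fin N → F)) (v : Fin N → F) : Submodule F (Fin N → F) :=
  U ⊓ LinearMap.ker ((dotProductBilin F F).flip v)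

theorem mem_cut {U : Submodule F (Fin N → F)} {v u : Fin N → F} :
    u ∈ cut U v ↔ u ∈ U ∧ u ⬝ᵥ v = 0 := Iff.rfl

/-- `L` lists the proper nonzero members of a complete flag of subspaces of `U`, the largest one
first. -/
def IsFullFlag : Submodule F (Fin N → F) → List (Submodule F (Fin N → F)) → Prop
  | U, [] => Module.finrank F U = 1
  | U, A :: L => IsHyperplane A U ∧ IsFullFlag A L

/-- The complete flags of `U` obtained by cutting successively with vectors
`v₁ ∈ e₁ + ⟨e₂, e₃, …⟩`, `v₂ ∈ e₂ + ⟨e₃, …⟩` and so on, such that no step is the same as cutting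
with `eᵢ`. -/
def IsGenericFlag : Submodule F (Fin N → F) → List (Fin N → F) →
    List (Submodule F (Fin N → F)) → Prop
  | _, [], _ => False
  | _, [_], L => L = []
  | _, _ :: _ :: _, [] => False
  | U, e :: e' :: es, A :: L => A ≠ cut U e ∧
      (∃ v, v - e ∈ Submodule.span F {x | x ∈ e' :: es} ∧ A = cut U v) ∧
      IsGenericFlag A (e' :: es) L

/-- Pairing with the vectors of `es` separates the points of `U`. -/
def Separates (U : Submodule F (Fin N → F)) (es : List (Fin N → F)) : Prop :=
  ∀ u ∈ U, (∀ e ∈ es, u ⬝ᵥ e = 0) → u = 0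

/-- The consequences of the cycle condition for a function `z` on the complete flags of a space
`U` of dimension `d`. -/
def IsCycleOn : ℕ → Submodule F (Fin N → F) → (List (Submodule F (Fin N → F)) → (Fin N → F)) → Prop
  | 0, _, _ => True
  | 1, _, _ => True
  | 2, U, z => ∀ A₀ A₁, IsHyperplane A₀ U → IsHyperplane A₁ U → A₀ ≠ A₁ →
      (∀ A, IsHyperplane A U → A ≠ A₀ → A ≠ A₁ → z [A] = 0) → z [A₀] = 0
  | d + 3, U, z => (∀ A, IsHyperplane A U → IsCycleOn (d + 2) A fun L => z (A :: L)) ∧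
      ∀ A₀ B L, IsHyperplane A₀ U → IsHyperplane B A₀ → IsFullFlag B L →
        (∀ A, IsHyperplane A U → IsHyperplane B A → A ≠ A₀ → z (A :: B :: L) = 0) →
        z (A₀ :: B :: L) = 0

theorem IsCycleOn.cons {d : ℕ} {U A : Submodule F (Fin N → F)}
    {z : List (Submodule F (Fin N → F)) → (Fin N → F)} (h : IsCycleOn (d + 2) U z)
    (hA : IsHyperplane A U) : IsCycleOn (d + 1) A fun L => z (A :: L) := by
  cases d with
  | zero => trivial
  | succ d => exact h.1 A hA

theorem IsHyperplane.eq_of_le {A B U : Submodule F (Fin N → F)} (hA : IsHyperplane A U)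
    (hB : IsHyperplane B U) (h : A ≤ B) : A = B :=
  Submodule.eq_of_le_of_finrank_eq h (by have := hA.2; have := hB.2; omega)

/-- Both spaces equal B + ⟨f⟩, since B has codimension one in each of them and misses f. -/
theorem IsHyperplane.eq_of_mem {A A' B U : Submodule F (Fin N → F)} {f : Fin N → F}
    (hA : IsHyperplane A U) (hA' : IsHyperplane A' U) (hB : IsHyperplane B A)
    (hB' : IsHyperplane B A') (hf : f ∈ A) (hf' : f ∈ A') (hfB : f ∉ B) : A = A' := by
  have hlt : B < A ⊓ A' := lt_of_le_of_ne (le_inf hB.1 hB'.1)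
    fun h => hfB (by rw [h]; exact ⟨hf, hf'⟩)
  have h1 := Submodule.finrank_lt_finrank_of_lt hlt
  have h2 : A ⊓ A' = A := Submodule.eq_of_le_of_finrank_le inf_le_left (by have := hB.2; omega)
  exact hA.eq_of_le hA' (inf_eq_left.1 h2)

theorem isHyperplane_cut {U : Submodule F (Fin N → F)} {v f : Fin N → F} (hf : f ∈ U)
    (hv : f ⬝ᵥ v ≠ 0) : IsHyperplane (cut U v) U := by
  refine ⟨inf_le_left, ?_⟩
  let g : Module.Dual F U := ((dotProductBilin F F).flip v) ∘ₗ U.subtype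
  have hg : g ≠ 0 := fun h => hv (LinearMap.congr_fun h ⟨f, hf⟩)
  have h1 := Module.Dual.finrank_ker_add_one_of_ne_zero hg
  have h2 : cut U v = (LinearMap.ker g).map U.subtype := by
    ext u
    simp only [mem_cut, Submodule.mem_map, LinearMap.mem_ker, Submodule.subtype_apply,
      Subtype.exists, exists_and_right, exists_eq_right]
    exact ⟨fun h => ⟨h.1, h.2⟩, fun ⟨h, h'⟩ => ⟨h, h'⟩⟩
  rw [h2, LinearEquiv.finrank_eq (Submodule.equivMapOfInjective U.subtype
    U.injective_subtype (LinearMap.ker g)).symm]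
  exact h1

theorem exists_dot_of_notMem {A : Submodule F (Fin N → F)} {u : Fin N → F} (hu : u ∉ A) :
    ∃ y : Fin N → F, (∀ a ∈ A, a ⬝ᵥ y = 0) ∧ u ⬝ᵥ y ≠ 0 := by
  obtain ⟨f, hfu, hf⟩ := Submodule.exists_le_ker_of_notMem hu
  have hdot : ∀ a, a ⬝ᵥ (fun i => f (Pi.single i 1)) = f a := by
    intro a
    conv_rhs => rw [pi_eq_sum_univ' a, map_sum]
    simp [dotProduct]
  refine ⟨fun i => f (Pi.single i 1), fun a ha => ?_, ?_⟩
  · rw [hdot]; exact hf ha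
  · rwa [hdot]

theorem IsHyperplane.exists_cut {A U : Submodule F (Fin N → F)} (h : IsHyperplane A U) :
    ∃ y, A = cut U y := by
  obtain ⟨u, huU, huA⟩ : ∃ u ∈ U, u ∉ A := by
    by_contra! hcon
    have := le_antisymm h.1 hcon
    have h2 := h.2
    rw [this] at h2
    omega
  obtain ⟨y, hy, hyu⟩ := exists_dot_of_notMem huA
  exact ⟨y, h.eq_of_le (isHyperplane_cut huU hyu) fun a ha => ⟨h.1 ha, hy a ha⟩⟩

/-- The functionals on U given by `es` have zero common kernel, hence span the dual of U. Only the
restriction of y to U matters. -/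
theorem Separates.exists_mem_span {U : Submodule F (Fin N → F)} {es : List (Fin N → F)}
    (h : Separates U es) (y : Fin N → F) :
    ∃ y' ∈ Submodule.span F {x | x ∈ es}, ∀ u ∈ U, u ⬝ᵥ y = u ⬝ᵥ y' := by
  let r : (Fin N → F) →ₗ[F] Module.Dual F U :=
    (LinearMap.lcomp F F U.subtype) ∘ₗ (dotProductBilin F F).flip
  have hr : ∀ x u, r x u = u.1 ⬝ᵥ x := fun _ _ => rfl
  have hm : r y ∈ Submodule.span F (Set.range fun i : Fin es.length => r es[i]) := by
    refine mem_span_of_iInf_ker_le_ker fun u hu => ?_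
    have : (u : Fin N → F) = 0 := by
      refine h u u.2 fun e he => ?_
      obtain ⟨i, hi, rfl⟩ := List.mem_iff_getElem.1 he
      exact (Submodule.mem_iInf _).1 hu ⟨i, hi⟩
    rw [LinearMap.mem_ker, hr, this, zero_dotProduct]
  have hset : (Set.range fun i : Fin es.length => r es[i]) = r '' {x | x ∈ es} := by
    ext t
    constructor
    · rintro ⟨i, rfl⟩
      exact ⟨_, List.getElem_mem _, rfl⟩
    · rintro ⟨e, he, rfl⟩
      obtain ⟨i, hi, rfl⟩ := List.mem_iff_getElem.1 he
      exact ⟨⟨i, hi⟩, rfl⟩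
  rw [hset, ← Submodule.map_span] at hm
  obtain ⟨y', hy', e⟩ := hm
  exact ⟨y', hy', fun u hu => (LinearMap.congr_fun e ⟨u, hu⟩).symm⟩

/-- The vectors of `es` impose one condition fewer than the dimension of U, so they have a common
nonzero zero in U. Separation forces it to pair nontrivially with e, and it can be rescaled. -/
theorem Separates.exists_dual {U : Submodule F (Fin N → F)} {e : Fin N → F}
    {es : List (Fin N → F)} (h : Separates U (e :: es))
    (hd : Module.finrank F U = es.length + 1) :
    ∃ f ∈ U, f ⬝ᵥ e = 1 ∧ ∀ x ∈ es, f ⬝ᵥ x = 0 := by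
  let g : U →ₗ[F] (Fin es.length → F) :=
    LinearMap.pi fun i => ((dotProductBilin F F).flip es[i]) ∘ₗ U.subtype
  have hker : LinearMap.ker g ≠ ⊥ := LinearMap.ker_ne_bot_of_finrank_lt (by
    rw [hd, Module.finrank_fin_fun]; omega)
  obtain ⟨u, hu, hu0⟩ := (Submodule.ne_bot_iff _).1 hker
  have hes : ∀ x ∈ es, (u : Fin N → F) ⬝ᵥ x = 0 := by
    intro x hx
    obtain ⟨i, hi, rfl⟩ := List.mem_iff_getElem.1 hx
    exact congrFun hu ⟨i, hi⟩
  have hue : (u : Fin N → F) ⬝ᵥ e ≠ 0 := by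
    intro h0
    apply hu0
    apply Subtype.ext
    refine h u u.2 fun x hx => ?_
    rcases List.mem_cons.1 hx with rfl | hx
    · exact h0
    · exact hes x hx
  refine ⟨((u : Fin N → F) ⬝ᵥ e)⁻¹ • u, U.smul_mem _ u.2, ?_, fun x hx => ?_⟩
  · rw [smul_dotProduct, smul_eq_mul, inv_mul_cancel₀ hue]
  · rw [smul_dotProduct, hes x hx, smul_zero]

theorem dot_eq_zero_of_mem_span {f y : Fin N → F} {s : Set (Fin N → F)}
    (hs : ∀ x ∈ s, f ⬝ᵥ x = 0) (hy : y ∈ Submodule.span F s) : f ⬝ᵥ y = 0 := by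
  have : Submodule.span F s ≤ LinearMap.ker (dotProductBilin F F f) :=
    Submodule.span_le.2 fun x hx => hs x hx
  exact this hy

theorem dot_eq_of_sub_mem_span {f v e : Fin N → F} {s : Set (Fin N → F)}
    (hs : ∀ x ∈ s, f ⬝ᵥ x = 0) (hv : v - e ∈ Submodule.span F s) : f ⬝ᵥ v = f ⬝ᵥ e := by
  have := dot_eq_zero_of_mem_span hs hv
  rwa [dotProduct_sub, sub_eq_zero] at this

/-- On vectors orthogonal to `es`, pairing with v and pairing with e agree, so the lost functional e
is recovered from the equation of the cut. -/
theorem Separates.cut {U : Submodule F (Fin N → F)} {e v : Fin N → F} {es : List (Fin N → F)}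
    (h : Separates U (e :: es)) (hv : v - e ∈ Submodule.span F {x | x ∈ es}) :
    Separates (cut U v) es := by
  intro u hu hes
  refine h u hu.1 fun x hx => ?_
  rcases List.mem_cons.1 hx with rfl | hx
  · rw [← dot_eq_of_sub_mem_span hes hv]
    exact hu.2
  · exact hes x hx

theorem Separates.isHyperplane_cut {U : Submodule F (Fin N → F)} {e v : Fin N → F}
    {es : List (Fin N → F)} (h : Separates U (e :: es))
    (hd : Module.finrank F U = es.length + 1)
    (hv : v - e ∈ Submodule.span F {x | x ∈ es}) : IsHyperplane (TwistedBuilding.cut U v) U := by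
  obtain ⟨f, hf, hfe, hfs⟩ := h.exists_dual hd
  refine TwistedBuilding.isHyperplane_cut hf ?_
  rw [dot_eq_of_sub_mem_span hfs hv, hfe]
  exact one_ne_zero

theorem IsGenericFlag.isFullFlag {es : List (Fin N → F)} :
    ∀ {U : Submodule F (Fin N → F)} {L : List (Submodule F (Fin N → F))},
      IsGenericFlag U es L → Separates U es → Module.finrank F U = es.length → IsFullFlag U L := by
  induction es with
  | nil => intro U L h; exact h.elim
  | cons e es ih =>
    intro U L h hs hd
    match es, L, h with
    | [], _, h =>
      cases h
      exact hd
    | e' :: es, A :: L, h =>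
      obtain ⟨-, ⟨v, hv, rfl⟩, hL⟩ := h
      have hH := hs.isHyperplane_cut hd hv
      refine ⟨hH, ih hL (hs.cut hv) ?_⟩
      have := hH.2
      rw [hd] at this
      simpa using this

/-- Steinitz exchange for spanning lists. -/
theorem exists_exchange {W : Type*} [AddCommGroup W] [Module F W] (es : List W) :
    ∀ {y : W}, y ∈ Submodule.span F {x | x ∈ es} → y ≠ 0 →
    ∃ es' : List W, es'.length + 1 = es.length ∧ (∀ x ∈ es', x ∈ es) ∧
      ∀ x ∈ es, x ∈ Submodule.span F (insert y {x | x ∈ es'}) := by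
  induction es with
  | nil => intro y hy h0; simp at hy; exact (h0 hy).elim
  | cons a es ih =>
    intro y hy h0
    have hset : {x | x ∈ a :: es} = insert a {x | x ∈ es} := by ext; simp
    rw [hset] at hy
    obtain ⟨c, y', hy', rfl⟩ := Submodule.mem_span_insert.1 hy
    by_cases hc : c = 0
    · subst hc
      rw [zero_smul, zero_add] at h0 ⊢
      obtain ⟨es', h1, h2, h3⟩ := ih hy' h0
      refine ⟨a :: es', by simp [← h1], ?_, ?_⟩
      · intro x hx
        rcases List.mem_cons.1 hx with rfl | hx
        · exact List.mem_cons_self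
        · exact List.mem_cons_of_mem _ (h2 x hx)
      · intro x hx
        rcases List.mem_cons.1 hx with rfl | hx
        · exact Submodule.subset_span (Or.inr List.mem_cons_self)
        · exact Submodule.span_mono (Set.insert_subset_insert fun t ht =>
            List.mem_cons_of_mem _ ht) (h3 x hx)
    · refine ⟨es, rfl, fun x hx => List.mem_cons_of_mem _ hx, ?_⟩
      intro x hx
      rcases List.mem_cons.1 hx with rfl | hx
      · refine Submodule.mem_span_insert.2 ⟨c⁻¹, -(c⁻¹ • y'),
          Submodule.neg_mem _ (Submodule.smul_mem _ _ hy'), ?_⟩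
        rw [smul_add, smul_smul, inv_mul_cancel₀ hc, one_smul, add_neg_cancel_right]
      · exact Submodule.subset_span (Or.inr hx)

/-- A hyperplane through a point `f` dual to the first vector is separated by the first vector and
all but one of the others. -/
theorem Separates.exists_separates_of_mem {U A : Submodule F (Fin N → F)} {e f : Fin N → F}
    {es : List (Fin N → F)} (h : Separates U (e :: es)) (hA : IsHyperplane A U) (hfA : f ∈ A)
    (hfe : f ⬝ᵥ e = 1) (hfs : ∀ x ∈ es, f ⬝ᵥ x = 0) :
    ∃ es' : List (Fin N → F), es'.length + 1 = es.length ∧ (∀ x ∈ es', f ⬝ᵥ x = 0) ∧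
      Separates A (e :: es') := by
  obtain ⟨y₀, rfl⟩ := hA.exists_cut
  obtain ⟨y, hy, hyy⟩ := h.exists_mem_span y₀
  have hset : {x | x ∈ e :: es} = insert e {x | x ∈ es} := by ext; simp
  rw [hset] at hy
  obtain ⟨c, y', hy', rfl⟩ := Submodule.mem_span_insert.1 hy
  -- Evaluating the equation of the hyperplane at f isolates the coefficient of e. The equation
  -- therefore involves only `es`, and the exchange can drop a member of `es` while keeping e.
  have hc : c = 0 := by
    have h1 := hyy f hfA.1
    rw [(mem_cut.1 hfA).2, dotProduct_add, dot_eq_zero_of_mem_span hfs hy', dotProduct_smul,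
      hfe] at h1
    simpa using h1.symm
  subst hc
  rw [zero_smul, zero_add] at hyy
  have hy0 : y' ≠ 0 := by
    rintro rfl
    have : TwistedBuilding.cut U y₀ = U :=
      le_antisymm inf_le_left fun u hu => ⟨hu, by simpa using hyy u hu⟩
    have h2 := hA.2
    rw [this] at h2
    omega
  obtain ⟨es', h1, h2, h3⟩ := exists_exchange es hy' hy0
  refine ⟨es', h1, fun x hx => hfs x (h2 x hx), fun u hu hes => h u hu.1 fun x hx => ?_⟩
  rcases List.mem_cons.1 hx with rfl | hx
  · exact hes x List.mem_cons_self
  · refine dot_eq_zero_of_mem_span ?_ (h3 x hx)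
    rintro t (rfl | ht)
    · rw [← hyy u hu.1]
      exact hu.2
    · exact hes t (List.mem_cons_of_mem _ ht)

/-- Because f is not in A, the coefficient of e in an equation of A is nonzero and can be normalised
to 1. -/
theorem Separates.exists_cut_of_notMem {U A : Submodule F (Fin N → F)} {e f : Fin N → F}
    {es : List (Fin N → F)} (h : Separates U (e :: es)) (hA : IsHyperplane A U) (hfU : f ∈ U)
    (hfA : f ∉ A) (hfs : ∀ x ∈ es, f ⬝ᵥ x = 0) :
    ∃ v, v - e ∈ Submodule.span F {x | x ∈ es} ∧ A = TwistedBuilding.cut U v := by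
  obtain ⟨y₀, rfl⟩ := hA.exists_cut
  obtain ⟨y, hy, hyy⟩ := h.exists_mem_span y₀
  have hset : {x | x ∈ e :: es} = insert e {x | x ∈ es} := by ext; simp
  rw [hset] at hy
  obtain ⟨c, y', hy', rfl⟩ := Submodule.mem_span_insert.1 hy
  have hc : c ≠ 0 := by
    rintro rfl
    refine hfA ⟨hfU, ?_⟩
    change f ⬝ᵥ y₀ = 0
    rw [hyy f hfU, zero_smul, zero_add, dot_eq_zero_of_mem_span hfs hy']
  refine ⟨e + c⁻¹ • y', ?_, ?_⟩
  · rw [add_sub_cancel_left]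
    exact Submodule.smul_mem _ _ hy'
  · ext u
    rw [mem_cut, mem_cut]
    refine and_congr_right fun hu => ?_
    have : e + c⁻¹ • y' = c⁻¹ • (c • e + y') := by
      rw [smul_add, smul_smul, inv_mul_cancel₀ hc, one_smul]
    rw [hyy u hu, this, dotProduct_smul, smul_eq_mul, mul_eq_zero]
    simp [hc]

/-! ### The vanishing theorem, by induction on dimension -/

theorem eq_zero_of_generic (d : ℕ) : ∀ (U : Submodule F (Fin N → F)) (es : List (Fin N → F))
    (z : List (Submodule F (Fin N → F)) → (Fin N → F)), es.length = d → Module.finrank F U = d →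
    Separates U es → IsCycleOn d U z → (∀ L, IsGenericFlag U es L → z L = 0) →
    ∀ L, IsFullFlag U L → z L = 0 := by
  induction d with
  | zero =>
    intro U es z _ hd _ _ _ L hL
    cases L with
    | nil =>
      have : Module.finrank F U = 1 := hL
      omega
    | cons A L =>
      have := hL.1.2
      omega
  | succ d ih =>
    intro U es z hlen hd hs hz hgen L hL
    match d, es, hlen with
    | 0, [e], _ =>
      cases L with
      | nil => exact hgen [] rfl
      | cons A L =>
        have h1 := hL.1.2
        have h2 := hL.2
        cases L with
        | nil =>
          have : Module.finrank F A = 1 := h2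
          omega
        | cons B L =>
          have := h2.1.2
          omega
    | d + 1, e :: e' :: es, hlen =>
      have hlen' : (e' :: es).length = d + 1 := by simpa using hlen
      have hd' : Module.finrank F U = (e' :: es).length + 1 := by rw [hd, hlen']
      obtain ⟨f, hfU, hfe, hfs⟩ := hs.exists_dual hd'
      -- Such a hyperplane is an admissible first step of a generic flag, so the generic flags of A
      -- for the remaining list extend to generic flags of U.
      have hgood : ∀ A, IsHyperplane A U → f ∉ A → A ≠ cut U e →
          ∀ L, IsFullFlag A L → z (A :: L) = 0 := by
        intro A hA hfA hne
        obtain ⟨v, hv, rfl⟩ := hs.exists_cut_of_notMem hA hfU hfA hfs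
        refine ih (cut U v) (e' :: es) (fun L => z (cut U v :: L)) hlen' ?_ (hs.cut hv)
          (hz.cons hA) fun L hL => hgen _ ⟨hne, ⟨v, hv, rfl⟩, hL⟩
        have := hA.2
        omega
      have hN : IsHyperplane (cut U e) U := isHyperplane_cut hfU (by rw [hfe]; exact one_ne_zero)
      have hfN : f ∉ cut U e := fun h => one_ne_zero (hfe.symm.trans h.2)
      match d, hz with
      | 0, hz =>
        have hflag : ∀ A, IsHyperplane A U → IsFullFlag A [] := by
          intro A hA
          change Module.finrank F A = 1
          have := hA.2
          omega
        cases L with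
        | nil =>
          have : Module.finrank F U = 1 := hL
          omega
        | cons A L =>
          have hA := hL.1
          cases L with
          | cons B L =>
            have h1 := hA.2
            have h2 := hL.2.1.2
            have h3 := hL.2.2
            cases L with
            | nil =>
              have : Module.finrank F B = 1 := h3
              omega
            | cons C L =>
              have := h3.1.2
              omega
          | nil =>
            -- In a plane only the lines ⟨f⟩ and e^⊥ escape `hgood`, and the two-line clause of the
            -- cycle condition kills both.
            have huniq : ∀ A A', IsHyperplane A U → IsHyperplane A' U → f ∈ A → f ∈ A' →
                A = A' := by
              intro A A' hA hA' hf hf'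
              refine hA.eq_of_mem hA' (B := ⊥) ⟨bot_le, ?_⟩ ⟨bot_le, ?_⟩ hf hf' ?_
              · rw [finrank_bot]; have := hA.2; omega
              · rw [finrank_bot]; have := hA'.2; omega
              · intro h
                rw [(Submodule.mem_bot F).1 h, zero_dotProduct] at hfe
                exact zero_ne_one hfe
            by_cases hfA : f ∈ A
            · refine hz A (cut U e) hA hN (fun h => hfN (h ▸ hfA)) fun A' hA' h1 h2 => ?_
              exact hgood A' hA' (fun h => h1 (huniq _ _ hA' hA h hfA)) h2 [] (hflag A' hA')
            · by_cases hAe : A = cut U e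
              · obtain ⟨C, hC, hfC⟩ : ∃ C, IsHyperplane C U ∧ f ∈ C := by
                  refine ⟨Submodule.span F {f}, ⟨?_, ?_⟩, Submodule.mem_span_singleton_self f⟩
                  · rw [Submodule.span_le]
                    simpa using hfU
                  · rw [finrank_span_singleton, hd]
                    rintro rfl
                    rw [zero_dotProduct] at hfe
                    exact zero_ne_one hfe
                refine hz A C hA hC (fun h => hfA (h ▸ hfC)) fun A' hA' h1 h2 => ?_
                exact hgood A' hA' (fun h => h2 (huniq _ _ hA' hC h hfC)) (hAe ▸ h1) []
                  (hflag A' hA')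
              · exact hgood A hA hfA hAe [] (hflag A hA)
      | d + 1, hz =>
        -- The induction hypothesis is applied to A with e kept as first functional. A generic flag
        -- of A then starts with some B not containing f and different from A ∩ e^⊥, and the cycle
        -- condition is used among the hyperplanes through B.
        have hthrough : ∀ A, IsHyperplane A U → f ∈ A → ∀ L, IsFullFlag A L → z (A :: L) = 0 := by
          intro A hA hfA
          obtain ⟨es', hl, hfs', hsA⟩ := hs.exists_separates_of_mem hA hfA hfe hfs
          have hdA : Module.finrank F A = (e :: es').length := by
            have := hA.2
            rw [List.length_cons, hl]
            omega
          refine ih A (e :: es') (fun L => z (A :: L)) (by rw [List.length_cons, hl, hlen'])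
            (by have := hA.2; omega) hsA (hz.cons hA) fun L hL => ?_
          have hfull := hL.isFullFlag hsA hdA
          match es', L, hl, hL with
          | [], _, hl, _ =>
            rw [hlen'] at hl
            simp at hl
          | e'' :: es', B :: L, _, hL =>
            obtain ⟨hne, ⟨v, hv, rfl⟩, -⟩ := hL
            refine hz.2 A _ L hA hfull.1 hfull.2 fun A' hA' hBA' hA'A => ?_
            refine hgood A' hA' (fun hf => ?_) (fun h => ?_) _ ⟨hBA', hfull.2⟩
            -- A is the only hyperplane containing both B and f. Indeed f ∉ B, because f pairs to 1
            -- with the vector cutting out B.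
            · refine hA'A (hA'.eq_of_mem hA hBA' hfull.1 hf hfA fun h => ?_)
              refine one_ne_zero (hfe.symm.trans ?_)
              rw [← dot_eq_of_sub_mem_span hfs' hv]
              exact h.2
            -- If A' were e^⊥, then B would lie in A ∩ e^⊥ and equal it, contrary to genericity.
            · refine hne (hfull.1.eq_of_le (isHyperplane_cut hfA ?_) fun u hu => ⟨hu.1, ?_⟩)
              · rw [hfe]; exact one_ne_zero
              · have := hBA'.1 hu
                rw [h] at this
                exact this.2
        cases L with
        | nil =>
          have : Module.finrank F U = 1 := hL
          omega
        | cons A L =>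
          obtain ⟨hA, hL⟩ := hL
          by_cases hfA : f ∈ A
          · exact hthrough A hA hfA L hL
          · by_cases hAe : A = cut U e
            · cases L with
              | nil =>
                have h1 : Module.finrank F A = 1 := hL
                have := hA.2
                omega
              | cons B L =>
                -- Here A = e^⊥. Every other hyperplane through B has already been treated, whether
                -- or not it contains f.
                refine hz.2 A B L hA hL.1 hL.2 fun A' hA' hBA' hne => ?_
                by_cases hfA' : f ∈ A'
                · exact hthrough A' hA' hfA' _ ⟨hBA', hL.2⟩
                · exact hgood A' hA' hfA' (hAe ▸ hne) _ ⟨hBA', hL.2⟩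
            · exact hgood A hA hfA hAe L hL

end Vanishing

/-! ### Cycles of the building as functions on complete flags -/

section Lists

variable {F : Type*} [Field F] {m : ℕ}

/-- The list `P` descends in steps of codimension one from `W` (excluded) to `U`. -/
def Descends : Submodule F (Fin (m + 1) → F) → List (Submodule F (Fin (m + 1) → F)) →
    Submodule F (Fin (m + 1) → F) → Prop
  | W, [], U => W = U
  | W, A :: P, U => IsHyperplane A W ∧ Descends A P U

theorem Descends.concat {P : List (Submodule F (Fin (m + 1) → F))} :
    ∀ {W U A : Submodule F (Fin (m + 1) → F)}, Descends W P U → IsHyperplane A U →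
      Descends W (P ++ [A]) A := by
  induction P with
  | nil =>
    intro W U A h hA
    have h' : W = U := h
    subst h'
    exact ⟨hA, rfl⟩
  | cons C P ih =>
    intro W U A h hA
    exact ⟨h.1, ih h.2 hA⟩

theorem Descends.finrank_le {P : List (Submodule F (Fin (m + 1) → F))} :
    ∀ {W U : Submodule F (Fin (m + 1) → F)}, Descends W P U →
      Module.finrank F U ≤ Module.finrank F W ∧
        ∀ A ∈ P, Module.finrank F U ≤ Module.finrank F A := by
  induction P with
  | nil =>
    intro W U h
    have h' : W = U := h
    subst h'
    simp
  | cons C P ih =>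
    intro W U h
    obtain ⟨h1, h2⟩ := ih h.2
    refine ⟨by have := h.1.2; omega, fun A hA => ?_⟩
    rcases List.mem_cons.1 hA with rfl | hA
    · exact h1
    · exact h2 A hA

theorem Descends.exists_finrank {P : List (Submodule F (Fin (m + 1) → F))} :
    ∀ {W U : Submodule F (Fin (m + 1) → F)}, Descends W P U → ∀ j, Module.finrank F U ≤ j →
      j < Module.finrank F W → ∃ A ∈ P, Module.finrank F A = j := by
  induction P with
  | nil =>
    intro W U h j h1 h2
    have h' : W = U := h
    subst h'
    omega
  | cons C P ih =>
    intro W U h j h1 h2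
    by_cases hj : j < Module.finrank F C
    · obtain ⟨A, hA, e⟩ := ih h.2 j h1 hj
      exact ⟨A, List.mem_cons_of_mem _ hA, e⟩
    · exact ⟨C, List.mem_cons_self, by have := h.1.2; omega⟩

theorem Descends.eq_or_mem {P : List (Submodule F (Fin (m + 1) → F))} :
    ∀ {W U : Submodule F (Fin (m + 1) → F)}, Descends W P U → W = U ∨ U ∈ P := by
  induction P with
  | nil => intro W U h; exact Or.inl h
  | cons C P ih =>
    intro W U h
    rcases ih h.2 with rfl | h'
    · exact Or.inr List.mem_cons_self
    · exact Or.inr (List.mem_cons_of_mem _ h')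

theorem IsFullFlag.finrank_lt {L : List (Submodule F (Fin (m + 1) → F))} :
    ∀ {U : Submodule F (Fin (m + 1) → F)}, IsFullFlag U L →
      1 ≤ Module.finrank F U ∧ ∀ A ∈ L, Module.finrank F A < Module.finrank F U := by
  induction L with
  | nil =>
    intro U h
    have h' : Module.finrank F U = 1 := h
    simp [h']
  | cons C L ih =>
    intro U h
    obtain ⟨h1, h2⟩ := ih h.2
    have h3 := h.1.2
    refine ⟨by omega, fun A hA => ?_⟩
    rcases List.mem_cons.1 hA with rfl | hA
    · omega
    · have := h2 A hA
      omega

theorem IsFullFlag.exists_finrank {L : List (Submodule F (Fin (m + 1) → F))} :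
    ∀ {U : Submodule F (Fin (m + 1) → F)}, IsFullFlag U L → ∀ j, 1 ≤ j →
      j < Module.finrank F U → ∃ A ∈ L, Module.finrank F A = j := by
  induction L with
  | nil =>
    intro U h j h1 h2
    have h' : Module.finrank F U = 1 := h
    omega
  | cons C L ih =>
    intro U h j h1 h2
    by_cases hj : j < Module.finrank F C
    · obtain ⟨A, hA, e⟩ := ih h.2 j h1 hj
      exact ⟨A, List.mem_cons_of_mem _ hA, e⟩
    · exact ⟨C, List.mem_cons_self, by have := h.1.2; omega⟩

/-- The nontrivial proper subspaces in a list. -/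
def properMembers (L : List (Submodule F (Fin (m + 1) → F))) : Finset (ProperSubspace F m) :=
  (L.filterMap fun A => if h : A ≠ ⊥ ∧ A ≠ ⊤ then some ⟨A, h⟩ else none).toFinset

theorem mem_properMembers {L : List (Submodule F (Fin (m + 1) → F))} {B : ProperSubspace F m} :
    B ∈ properMembers L ↔ B.val ∈ L := by
  simp only [properMembers, List.mem_toFinset, List.mem_filterMap]
  constructor
  · rintro ⟨A, hA, h⟩
    split_ifs at h with h'
    cases h
    exact hA
  · intro h
    exact ⟨B.val, h, by rw [dif_pos B.property]⟩

theorem ne_bot_ne_top {A : Submodule F (Fin (m + 1) → F)} (h1 : 1 ≤ Module.finrank F A)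
    (h2 : Module.finrank F A < m + 1) : A ≠ ⊥ ∧ A ≠ ⊤ := by
  constructor
  · rintro rfl
    simp at h1
  · rintro rfl
    simp at h2

theorem ProperSubspace.finrank_pos (A : ProperSubspace F m) : 1 ≤ Module.finrank F A.val :=
  Submodule.one_le_finrank_iff.2 A.property.1

theorem ProperSubspace.finrank_lt (A : ProperSubspace F m) : Module.finrank F A.val < m + 1 := by
  have := Submodule.finrank_lt A.property.2
  simpa using this

theorem eq_of_comparable {A B : Submodule F (Fin (m + 1) → F)} (h : A ≤ B ∨ B ≤ A)
    (hd : Module.finrank F A = Module.finrank F B) : A = B := by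
  rcases h with h | h
  · exact Submodule.eq_of_le_of_finrank_eq h hd
  · exact (Submodule.eq_of_le_of_finrank_eq h hd.symm).symm

theorem le_of_comparable {A B : Submodule F (Fin (m + 1) → F)} (h : A ≤ B ∨ B ≤ A)
    (hd : Module.finrank F A ≤ Module.finrank F B) : A ≤ B := by
  rcases h with h | h
  · exact h
  · exact (Submodule.eq_of_le_of_finrank_le h hd).ge

theorem comparable_of_face {s : ProperSubspace F m} {t : Finset (ProperSubspace F m)}
    (h : insert s t ∈ (building F m).faces) {B : ProperSubspace F m} (hB : B ∈ t) :
    s.val ≤ B.val ∨ B.val ≤ s.val := by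
  have h' : IsChain (· ≤ ·) (↑(insert s t) : Set (ProperSubspace F m)) := h
  exact h'.total (by simp) (by simp [hB])

/-- P realises every dimension from dim U to m and Q every positive dimension below dim U - 1, so
dimension dim U - 1 is the only one left for a new member. Comparability with U then places it
inside U. -/
theorem isHyperplane_of_face {P Q : List (Submodule F (Fin (m + 1) → F))}
    {U : Submodule F (Fin (m + 1) → F)} (hP : Descends ⊤ P U)
    (hQ : ∀ j, 1 ≤ j → j + 1 < Module.finrank F U → ∃ A ∈ Q, Module.finrank F A = j)
    {s : ProperSubspace F m} (hs : s ∉ properMembers (P ++ Q))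
    (h : insert s (properMembers (P ++ Q)) ∈ (building F m).faces) : IsHyperplane s.val U := by
  have hs1 := s.finrank_pos
  have hs2 := s.finrank_lt
  have hno : ∀ A ∈ P ++ Q, Module.finrank F A ≠ Module.finrank F s.val := by
    intro A hA hd
    have hA' : A ≠ ⊥ ∧ A ≠ ⊤ := ne_bot_ne_top (by omega) (by omega)
    have hm : (⟨A, hA'⟩ : ProperSubspace F m) ∈ properMembers (P ++ Q) := mem_properMembers.2 hA
    have := eq_of_comparable (comparable_of_face h hm) hd.symm
    exact hs (by rwa [mem_properMembers, this])
  have htop : Module.finrank F (⊤ : Submodule F (Fin (m + 1) → F)) = m + 1 := by simp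
  have hlt : Module.finrank F s.val < Module.finrank F U := by
    by_contra hcon
    obtain ⟨A, hA, e⟩ := hP.exists_finrank _ (not_lt.1 hcon) (by omega)
    exact hno A (List.mem_append_left _ hA) e
  have heq : Module.finrank F s.val + 1 = Module.finrank F U := by
    by_contra hcon
    obtain ⟨A, hA, e⟩ := hQ _ hs1 (by omega)
    exact hno A (List.mem_append_right _ hA) e
  refine ⟨?_, heq⟩
  rcases hP.eq_or_mem with rfl | hU
  · exact le_top
  · have hU' : U ≠ ⊥ ∧ U ≠ ⊤ := by
      refine ne_bot_ne_top (by omega) ?_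
      by_contra hcon
      have : U = ⊤ := Submodule.eq_top_of_finrank_eq
        (le_antisymm (Submodule.finrank_le U) (by rw [Module.finrank_fin_fun]; omega))
      subst this
      cases P with
      | nil => simp at hU
      | cons A P =>
        have h1 := hP.1.2
        have h2 := hP.2.finrank_le.1
        omega
    have hm : (⟨U, hU'⟩ : ProperSubspace F m) ∈ properMembers (P ++ Q) :=
      mem_properMembers.2 (List.mem_append_left _ hU)
    exact le_of_comparable (comparable_of_face h hm) hlt.le

/-- The coefficient of a chain of the building at a set of subspaces, as a vector of `V`. -/
def coeff {k : ℕ} (z : (taut F m).Chain k) (t : Finset (ProperSubspace F m)) : Fin (m + 1) → F :=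
  (taut F m).toFinsupp tautIncl k z t

theorem coeff_mem {k : ℕ} (z : (taut F m).Chain k) (t : Finset (ProperSubspace F m))
    {A : ProperSubspace F m} (hA : A ∈ t) : coeff z t ∈ A.val := by
  by_cases h : t ∈ (building F m).faces ∧ t.card = k
  · have := (taut F m).toFinsupp_apply tautIncl z ⟨⟨t, h.1⟩, h.2⟩
    rw [coeff]
    change (taut F m).toFinsupp tautIncl k z t = _ at this
    rw [this]
    exact (z ⟨⟨t, h.1⟩, h.2⟩).2 A hA
  · rw [coeff, (taut F m).toFinsupp_apply_of_not _ _ _ h]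
    exact zero_mem _

theorem mem_faces_of_coeff_ne_zero {k : ℕ} {z : (taut F m).Chain k}
    {t : Finset (ProperSubspace F m)} (h : coeff z t ≠ 0) : t ∈ (building F m).faces := by
  by_contra hcon
  exact h ((taut F m).toFinsupp_apply_of_not _ _ _ fun h' => hcon h'.1)

theorem vertexSign_smul_eq_zero {t : Finset (ProperSubspace F m)} {s : ProperSubspace F m}
    {x : Fin (m + 1) → F} :
    LocalSystem.vertexSign (building F m) t s • x = 0 ↔ x = 0 := by
  rw [LocalSystem.vertexSign]
  rcases neg_one_pow_eq_or ℤ (t.filter fun r => (building F m).lt r s).card with h | h <;>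
    simp [h]

theorem sum_coeff_insert [Fintype (ProperSubspace F m)] {k : ℕ} {z : (taut F m).Chain (k + 1)}
    (hz : (taut F m).boundary k z = 0) (t : Finset (ProperSubspace F m)) :
    ∑ s : ProperSubspace F m with s ∉ t,
      LocalSystem.vertexSign (building F m) (insert s t) s • coeff z (insert s t) = 0 := by
  have := (taut F m).toFinsupp_boundary_apply tautIncl (fun h x => tautIncl_res h x) z t
  rw [hz, map_zero] at this
  exact this.symm

theorem insert_properMembers {P Q : List (Submodule F (Fin (m + 1) → F))}
    (A : ProperSubspace F m) :
    insert A (properMembers (P ++ Q)) = properMembers (P ++ A.val :: Q) := by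
  ext B
  simp only [Finset.mem_insert, mem_properMembers, List.mem_append, List.mem_cons]
  constructor
  · rintro (rfl | h | h) <;> simp [*]
  · rintro (h | h | h)
    · simp [h]
    · exact Or.inl (ProperSubspace.ext h)
    · simp [h]

/-- The boundary of z is evaluated at a flag lacking one member between U and B, or below U when dim
U = 2. Its nonzero terms come from the hyperplanes of U that contain B, each with a sign ±1, so if
all terms but one vanish the last one does too. The list P records the members from the top down to
U. -/
theorem isCycleOn_coeff [Fintype (ProperSubspace F m)] {k : ℕ} {z : (taut F m).Chain (k + 1)}
    (hz : (taut F m).boundary k z = 0) (d : ℕ) :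
    ∀ (U : Submodule F (Fin (m + 1) → F)) (P : List (Submodule F (Fin (m + 1) → F))),
      Descends ⊤ P U → Module.finrank F U = d →
      IsCycleOn d U fun L => coeff z (properMembers (P ++ L)) := by
  have hproper : ∀ {A U : Submodule F (Fin (m + 1) → F)} {d : ℕ}, IsHyperplane A U →
      Module.finrank F U = d + 2 → A ≠ ⊥ ∧ A ≠ ⊤ := by
    intro A U d hA hd
    have h1 := hA.2
    have h2 := Submodule.finrank_le U
    rw [Module.finrank_fin_fun] at h2
    exact ne_bot_ne_top (by omega) (by omega)
  induction d with
  | zero => intros; trivial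
  | succ d ih =>
    intro U P hP hd
    match d, ih with
    | 0, _ => trivial
    | 1, _ =>
      intro A₀ A₁ h₀ h₁ hne hA
      let a₀ : ProperSubspace F m := ⟨A₀, hproper h₀ hd⟩
      let a₁ : ProperSubspace F m := ⟨A₁, hproper h₁ hd⟩
      have hnotin : ∀ a : ProperSubspace F m, IsHyperplane a.val U →
          a ∈ ({s | s ∉ properMembers (P ++ [])} : Finset (ProperSubspace F m)) := by
        intro a ha
        simp only [Finset.mem_filter, Finset.mem_univ, true_and, mem_properMembers, List.append_nil]
        intro hm
        have := hP.finrank_le.2 _ hm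
        have := ha.2
        omega
      have hsum := sum_coeff_insert hz (properMembers (P ++ []))
      rw [Finset.sum_eq_add a₀ a₁ (fun h => hne (congrArg ProperSubspace.val h)) ?_
        (fun h => (h (hnotin a₀ h₀)).elim) (fun h => (h (hnotin a₁ h₁)).elim)] at hsum
      · rw [insert_properMembers, insert_properMembers] at hsum
        have m0 : coeff z (properMembers (P ++ [A₀])) ∈ A₀ :=
          coeff_mem z _ (A := a₀) (by simp [mem_properMembers, a₀])
        have m1 : coeff z (properMembers (P ++ [A₁])) ∈ A₁ :=
          coeff_mem z _ (A := a₁) (by simp [mem_properMembers, a₁])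
        -- Two terms remain, with values in two distinct lines and with sum zero, so each lies in
        -- the trivial intersection.
        have hinf : A₀ ⊓ A₁ = ⊥ := by
          by_contra hcon
          have h1 : 1 ≤ Module.finrank F (A₀ ⊓ A₁ : Submodule F (Fin (m + 1) → F)) :=
            Submodule.one_le_finrank_iff.2 hcon
          have h2 := h₀.2
          have h3 : A₀ ⊓ A₁ = A₀ :=
            Submodule.eq_of_le_of_finrank_le inf_le_left (by omega)
          exact hne (h₀.eq_of_le h₁ (inf_eq_left.1 h3))
        have hx : LocalSystem.vertexSign (building F m) (properMembers (P ++ [A₀])) a₀ •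
            coeff z (properMembers (P ++ [A₀])) = 0 := by
          have hmem : LocalSystem.vertexSign (building F m) (properMembers (P ++ [A₀])) a₀ •
              coeff z (properMembers (P ++ [A₀])) ∈ A₀ ⊓ A₁ := by
            refine ⟨zsmul_mem m0 _, ?_⟩
            rw [eq_neg_of_add_eq_zero_left hsum]
            exact neg_mem (zsmul_mem m1 _)
          rw [hinf] at hmem
          exact (Submodule.mem_bot F).1 hmem
        exact vertexSign_smul_eq_zero.1 hx
      · intro s hs hs'
        rw [vertexSign_smul_eq_zero]
        by_contra h0
        have hh := isHyperplane_of_face hP (Q := []) (fun j h1 h2 => by omega)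
          (Finset.mem_filter.1 hs).2 (mem_faces_of_coeff_ne_zero h0)
        rw [insert_properMembers] at h0
        exact h0 (hA s.val hh (fun h => hs'.1 (ProperSubspace.ext h))
          (fun h => hs'.2 (ProperSubspace.ext h)))
    | d + 2, ih =>
      constructor
      · intro A hA
        have := ih A (P ++ [A]) (hP.concat hA) (by have := hA.2; omega)
        simpa using this
      · intro A₀ B L h₀ hB hL hA
        let a₀ : ProperSubspace F m := ⟨A₀, hproper h₀ hd⟩
        have hB2 := hB.2
        have h₀2 := h₀.2
        have hin : a₀ ∈ ({s | s ∉ properMembers (P ++ B :: L)} : Finset (ProperSubspace F m)) := by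
          simp only [Finset.mem_filter, Finset.mem_univ, true_and, mem_properMembers,
            List.mem_append, List.mem_cons]
          rintro (hm | hm | hm)
          · have := hP.finrank_le.2 _ hm
            change _ ≤ Module.finrank F A₀ at this
            omega
          · have : A₀ = B := hm
            rw [this] at hB2
            omega
          · have := hL.finrank_lt.2 _ hm
            change Module.finrank F A₀ < _ at this
            omega
        have hsum := sum_coeff_insert hz (properMembers (P ++ B :: L))
        rw [Finset.sum_eq_single_of_mem a₀ hin, vertexSign_smul_eq_zero,
          insert_properMembers] at hsum
        · exact hsum
        · intro s hs hs'
          rw [vertexSign_smul_eq_zero]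
          by_contra h0
          have hface := mem_faces_of_coeff_ne_zero h0
          have hh := isHyperplane_of_face hP (Q := B :: L) (fun j h1 h2 => by
              by_cases hj : j < Module.finrank F B
              · obtain ⟨A, hA, e⟩ := hL.exists_finrank j h1 hj
                exact ⟨A, List.mem_cons_of_mem _ hA, e⟩
              · exact ⟨B, List.mem_cons_self, by omega⟩)
            (Finset.mem_filter.1 hs).2 hface
          have hBp : B ≠ ⊥ ∧ B ≠ ⊤ := by
            have h2 := s.finrank_lt
            have := hh.2
            exact ne_bot_ne_top hL.finrank_lt.1 (by omega)
          have hBs : B ≤ s.val := by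
            refine le_of_comparable (comparable_of_face hface (B := ⟨B, hBp⟩) ?_).symm ?_
            · simp [mem_properMembers]
            · have := hh.2
              change Module.finrank F B ≤ _
              omega
          rw [insert_properMembers] at h0
          exact h0 (hA s.val hh ⟨hBs, by have := hh.2; omega⟩
            fun h => hs' (ProperSubspace.ext h))

theorem chain_finrank_injOn {t : Finset (ProperSubspace F m)} (ht : t ∈ (building F m).faces) :
    Set.InjOn (fun A : ProperSubspace F m => Module.finrank F A.val) (t : Set _) := by
  intro A hA B hB h
  have h' : IsChain (· ≤ ·) (t : Set (ProperSubspace F m)) := ht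
  exact ProperSubspace.ext (eq_of_comparable (h'.total hA hB) h)

/-- The d members of the chain have distinct dimensions in 1, …, d, so every dimension occurs. The
member of codimension one is split off first. -/
theorem exists_isFullFlag (d : ℕ) : ∀ (U : Submodule F (Fin (m + 1) → F))
    (t : Finset (ProperSubspace F m)), Module.finrank F U = d + 1 → t ∈ (building F m).faces →
    t.card = d → (∀ A ∈ t, A.val < U) → ∃ L, IsFullFlag U L ∧ properMembers L = t := by
  induction d with
  | zero =>
    intro U t hU _ ht _
    rw [Finset.card_eq_zero] at ht
    refine ⟨[], hU, ?_⟩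
    ext B
    simp [mem_properMembers, ht]
  | succ d ih =>
    intro U t hU ht hcard hlt
    have himg : t.image (fun A => Module.finrank F A.val) = Finset.Icc 1 (d + 1) := by
      refine Finset.eq_of_subset_of_card_le ?_ ?_
      · intro j hj
        obtain ⟨A, hA, rfl⟩ := Finset.mem_image.1 hj
        have := Submodule.finrank_lt_finrank_of_lt (hlt A hA)
        have := A.finrank_pos
        rw [Finset.mem_Icc]
        omega
      · rw [Finset.card_image_of_injOn (chain_finrank_injOn ht), hcard]
        simp
    obtain ⟨A, hA, hAd⟩ := Finset.mem_image.1
      (himg ▸ Finset.mem_Icc.2 ⟨by omega, le_rfl⟩ : d + 1 ∈ t.image _)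
    obtain ⟨L, hL, hLt⟩ := ih A.val (t.erase A) hAd
      ((building F m).down_closed ht (Finset.erase_subset _ _))
      (by rw [Finset.card_erase_of_mem hA, hcard]; rfl) (by
        intro B hB
        have hBt := Finset.mem_of_mem_erase hB
        have h' : IsChain (· ≤ ·) (t : Set (ProperSubspace F m)) := ht
        have h1 := Submodule.finrank_lt_finrank_of_lt (hlt B hBt)
        refine lt_of_le_of_ne (le_of_comparable (h'.total hBt hA) (by omega))
          fun h => Finset.ne_of_mem_erase hB (ProperSubspace.ext h))
    refine ⟨A.val :: L, ⟨⟨(hlt A hA).le, by omega⟩, hL⟩, ?_⟩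
    have := insert_properMembers (P := []) (Q := L) A
    simp only [List.nil_append] at this
    rw [← this, hLt, Finset.insert_erase hA]

theorem card_le_of_mem_faces {t : Finset (ProperSubspace F m)} (ht : t ∈ (building F m).faces) :
    t.card ≤ m := by
  rw [← Finset.card_image_of_injOn (chain_finrank_injOn ht)]
  refine (Finset.card_le_card (t := Finset.Icc 1 m) fun j hj => ?_).trans (by simp)
  obtain ⟨A, -, rfl⟩ := Finset.mem_image.1 hj
  have := A.finrank_lt
  have := A.finrank_pos
  rw [Finset.mem_Icc]
  omega

variable (F m) in
/-- The list of the standard basis vectors. -/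
def stdList : List (Fin (m + 1) → F) := List.ofFn (stdVec F)

theorem dot_stdVec (u : Fin (m + 1) → F) (p : Fin (m + 1)) : u ⬝ᵥ stdVec F p = u p := by
  simp [stdVec]

/-- A top-dimensional cycle is determined by its coefficients at the generic flags. -/
theorem cycle_eq_zero [Fintype (ProperSubspace F m)] {z : (taut F m).Chain m}
    (hz : z ∈ (taut F m).cycles m)
    (h : ∀ L, IsGenericFlag ⊤ (stdList F m) L → coeff z (properMembers L) = 0) : z = 0 := by
  have hcyc : IsCycleOn (m + 1) (⊤ : Submodule F (Fin (m + 1) → F))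
      fun L => coeff z (properMembers L) := by
    cases m with
    | zero => trivial
    | succ k => exact isCycleOn_coeff (m := k + 1) hz (k + 2) ⊤ [] rfl (by simp)
  have hall := eq_zero_of_generic (m + 1) ⊤ (stdList F m) _ (by simp [stdList]) (by simp)
    (by
      intro u _ hu
      ext p
      rw [← dot_stdVec u p]
      exact hu _ (List.mem_ofFn.2 ⟨p, rfl⟩)) hcyc h
  apply (taut F m).toFinsupp_injective tautIncl tautIncl_injective m
  rw [map_zero]
  ext1 t
  by_cases ht : t ∈ (building F m).faces ∧ t.card = m
  · obtain ⟨L, hL, rfl⟩ := exists_isFullFlag m ⊤ t (by simp) ht.1 ht.2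
      fun A _ => lt_top_iff_ne_top.2 A.property.2
    exact hall L hL
  · rw [(taut F m).toFinsupp_apply_of_not _ _ _ ht]
    rfl

/-- The recursive definition is unrolled into one sequence of cutting vectors. The lengths differ by
one because the last vector of `es` is never used for a cut; it only measures the final line. -/
theorem IsGenericFlag.exists_vectors {es : List (Fin (m + 1) → F)} :
    ∀ {U : Submodule F (Fin (m + 1) → F)} {L : List (Submodule F (Fin (m + 1) → F))},
      IsGenericFlag U es L → es.length = L.length + 1 ∧ ∃ v : ℕ → Fin (m + 1) → F,
        ∀ i (hi : i < L.length) (hi' : i < es.length),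
          v i - es[i] ∈ Submodule.span F {x | x ∈ es.drop (i + 1)} ∧ v i ≠ es[i] ∧
            ∀ u, u ∈ L[i] ↔ u ∈ U ∧ ∀ j ≤ i, u ⬝ᵥ v j = 0 := by
  induction es with
  | nil => intro U L h; exact h.elim
  | cons e es ih =>
    intro U L h
    match es, L, h with
    | [], _, h =>
      cases h
      exact ⟨rfl, fun _ => 0, fun i hi => absurd hi (by simp)⟩
    | e' :: es, A :: L, h =>
      obtain ⟨hne, ⟨w, hw, rfl⟩, hL⟩ := h
      obtain ⟨hlen, v, hv⟩ := ih hL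
      refine ⟨by rw [List.length_cons, hlen, List.length_cons],
        fun i => Nat.casesOn i w v, fun i hi hi' => ?_⟩
      cases i with
      | zero =>
        refine ⟨by simpa using hw, fun h => hne (congrArg (cut U) h), fun u => ?_⟩
        simp only [List.getElem_cons_zero, mem_cut]
        refine and_congr_right fun _ => ⟨fun h j hj => ?_, fun h => h 0 le_rfl⟩
        obtain rfl : j = 0 := by omega
        exact h
      | succ i =>
        obtain ⟨h1, h2, h3⟩ := hv i (by simpa using hi) (by simpa using hi')
        refine ⟨by simpa using h1, by simpa using h2, fun u => ?_⟩
        simp only [List.getElem_cons_succ]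
        rw [h3, mem_cut, and_assoc]
        refine and_congr_right fun _ => ⟨?_, fun h => ⟨h 0 (Nat.zero_le _), fun j hj =>
          h (j + 1) (by omega)⟩⟩
        rintro ⟨h4, h5⟩ j hj
        cases j with
        | zero => exact h4
        | succ j => exact h5 j (by omega)

end Lists

/-! ### Evaluating the cycles at the flags of the index set -/

section Evaluation

variable {F : Type*} [Field F] {m : ℕ}

/-- The flag `⟨v₁⟩^⊥ ⊃ ⟨v₁, v₂⟩^⊥ ⊃ ⋯`. -/
def baseFlag (v : IndexT F m) : (building F m).Simplex m :=
  (fMap v).mapSimplex (flagSimplex (seqA (fun _ => true) ∘ (1 : Equiv.Perm (Fin m)))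
    (seqA_mem _ 1) ((seqA_injective _).comp (Equiv.injective (1 : Equiv.Perm (Fin m)))))

theorem mem_fVertex_prefixVertex (v : IndexT F m) (x : Fin m → Vertex m)
    (hx : Finset.univ.image x ∈ (coneComplex m).faces) (i : Fin m) (u : Fin (m + 1) → F) :
    u ∈ (fVertex v (prefixVertex x hx i)).val ↔ ∀ j ≤ i, u ⬝ᵥ theta v (x j) = 0 := by
  refine (mem_perpTheta v _ u).trans ⟨fun h j hj => ?_, fun h y hy => ?_⟩
  · exact h _ (Finset.mem_image_of_mem _ (Finset.mem_Iic.2 hj))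
  · obtain ⟨j, hj, rfl⟩ := Finset.mem_image.1 hy
    exact h j (Finset.mem_Iic.1 hj)

theorem mem_mapSimplex_flagSimplex (v : IndexT F m) (x : Fin m → Vertex m)
    (hx : Finset.univ.image x ∈ (coneComplex m).faces) (hinj : Function.Injective x)
    (B : ProperSubspace F m) :
    B ∈ ((fMap v).mapSimplex (flagSimplex x hx hinj)).1.1 ↔
      ∃ i, fVertex v (prefixVertex x hx i) = B := by
  change B ∈ (Finset.univ.image (prefixVertex x hx)).image (fVertex v) ↔ _
  simp

theorem mem_baseFlag (v : IndexT F m) (B : ProperSubspace F m) :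
    B ∈ (baseFlag v).1.1 ↔ ∃ i : Fin m, ∀ u, u ∈ B.val ↔ ∀ j ≤ i, u ⬝ᵥ v.1 j = 0 := by
  rw [baseFlag, mem_mapSimplex_flagSimplex]
  refine exists_congr fun i => ⟨?_, fun h => ?_⟩
  · rintro rfl u
    exact mem_fVertex_prefixVertex v _ _ i u
  · apply ProperSubspace.ext
    ext u
    rw [h]
    exact mem_fVertex_prefixVertex v _ _ i u

/-- The vectors v₁, …, v_{n-1}, e_n are unitriangular. If u had a last nonzero coordinate p, its
pairing with the vector whose leading position is p would be that coordinate. -/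
theorem eq_zero_of_dot_eq_zero (v : IndexT F m) {u : Fin (m + 1) → F}
    (h : ∀ j, u ⬝ᵥ v.1 j = 0) (hl : u ⬝ᵥ stdVec F (Fin.last m) = 0) : u = 0 := by
  have hθ : ∀ p : Fin (m + 1), ∃ x : Vertex m, x.pos = p ∧ u ⬝ᵥ theta v x = 0 := by
    intro p
    induction p using Fin.lastCases with
    | last => exact ⟨Vertex.b, rfl, hl⟩
    | cast i => exact ⟨Vertex.a i true, rfl, h i⟩
  by_contra h0
  obtain ⟨q, hq⟩ := Function.ne_iff.1 h0
  obtain ⟨p, hp, hmax⟩ := Finset.exists_max_image (Finset.univ.filter fun p => u p ≠ 0) id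
    ⟨q, by simpa using hq⟩
  obtain ⟨x, rfl, hx⟩ := hθ p
  rw [dotProduct, Finset.sum_eq_single x.pos, theta_pos, mul_one] at hx
  · exact (Finset.mem_filter.1 hp).2 hx
  · intro r _ hr
    rcases lt_or_gt_of_ne hr with hlt | hgt
    · rw [theta_lower v x hlt, mul_zero]
    · have : u r = 0 := by
        by_contra hne
        exact absurd (hmax r (by simpa using hne)) (not_le.2 hgt)
      rw [this, zero_mul]
  · intro h
    exact (h (Finset.mem_univ _)).elim

theorem index_apply_of_lt (u : IndexT F m) {j l : Fin m} (h : j < l) : u.1 l j.castSucc = 0 :=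
  theta_lower u (Vertex.a l true) (p := j.castSucc) (Fin.castSucc_lt_castSucc_iff.2 h)

theorem index_apply_self (u : IndexT F m) (j : Fin m) : u.1 j j.castSucc = 1 :=
  theta_pos u (Vertex.a j true)

/-- Among the flags in the image of `f_v`, the base flag of `u` can only be the one belonging to
`a^{(1, …, 1)}`, and only if `v = u`. -/
theorem eq_of_mapSimplex_eq_baseFlag {v u : IndexT F m} {x : Fin m → Vertex m}
    (hx : Finset.univ.image x ∈ (coneComplex m).faces) (hinj : Function.Injective x)
    (h : ((fMap v).mapSimplex (flagSimplex x hx hinj)).1.1 = (baseFlag u).1.1) (i : Fin m) :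
    x i = Vertex.a i true ∧ v.1 i = u.1 i := by
  have hanti : ∀ (v : IndexT F m) (x : Fin m → Vertex m)
      (hx : Finset.univ.image x ∈ (coneComplex m).faces), Function.Injective x →
      StrictAnti fun i => fVertex v (prefixVertex x hx i) := by
    intro v x hx hinj i j hij
    refine fVertex_lt v ?_
    change (Finset.Iic i).image x ⊂ (Finset.Iic j).image x
    rwa [Finset.image_ssubset_image hinj, Finset.Iic_ssubset_Iic]
  -- Both flags are enumerated in strictly decreasing order, so equal vertex sets give equal members
  -- at each index.
  have hfun := (StrictMono.range_inj (hanti v x hx hinj).dual_right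
    (hanti u _ (seqA_mem (fun _ => true) 1)
      ((seqA_injective _).comp (Equiv.injective (1 : Equiv.Perm (Fin m))))).dual_right).1 (by
      ext B
      exact (mem_mapSimplex_flagSimplex v x hx hinj (OrderDual.ofDual B)).symm.trans
        ((Finset.ext_iff.1 h (OrderDual.ofDual B)).trans
          (mem_mapSimplex_flagSimplex u _ _ _ (OrderDual.ofDual B))))
  have hperp : ∀ (i : Fin m) (w : Fin (m + 1) → F),
      (∀ j ≤ i, w ⬝ᵥ theta v (x j) = 0) ↔ ∀ j ≤ i, w ⬝ᵥ u.1 j = 0 := by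
    intro i w
    have e : fVertex v (prefixVertex x hx i) = fVertex u (prefixVertex _ _ i) := congrFun hfun i
    rw [← mem_fVertex_prefixVertex v x hx, e]
    exact mem_fVertex_prefixVertex u _ _ i w
  induction i using WellFoundedLT.induction with
  | ind i ih =>
    set y := theta v (x i) with hy
    let u' : Fin m → Fin (m + 1) → F := fun j => if j ≤ i then u.1 j else 0
    -- Equality of the i-th orthogonal complements puts θ(x_i) into ⟨u₁, …, u_i⟩; otherwise some
    -- vector would be orthogonal to the u_j but not to θ(x_i).
    have hspan : y ∈ Submodule.span F (Set.range u') := by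
      by_contra hcon
      obtain ⟨w, hw, hyw⟩ := exists_dot_of_notMem hcon
      refine hyw ?_
      rw [dotProduct_comm]
      refine (hperp i w).2 (fun j hj => ?_) i le_rfl
      rw [dotProduct_comm]
      refine hw _ (Submodule.subset_span ⟨j, ?_⟩)
      simp [u', hj]
    obtain ⟨c, hc⟩ := (Submodule.mem_span_range_iff_exists_fun F).1 hspan
    -- By induction the positions below i are occupied by x₁, …, x_{i-1}, and positions are distinct
    -- on a simplex of K.
    have hpos : i.castSucc ≤ (x i).pos := by
      by_contra hcon
      rw [not_le] at hcon
      have hne : (x i).pos ≠ Fin.last m := (hcon.trans_le (Fin.le_last _)).ne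
      obtain ⟨j, hj⟩ := Fin.exists_castSucc_eq.2 hne
      have hji : j < i := by
        rw [← hj] at hcon
        exact Fin.castSucc_lt_castSucc_iff.1 hcon
      have : x j = x i := pos_injOn hx (by simp) (by simp) (by rw [(ih j hji).1, ← hj]; rfl)
      exact hji.ne (hinj this)
    have hcoord : ∀ q, y q = ∑ l, c l * u' l q := by
      intro q
      rw [← hc, Finset.sum_apply]
      rfl
    have hsingle : ∀ j ≤ i, (∀ l < j, c l = 0) → y j.castSucc = c j := by
      intro j hj hl
      rw [hcoord, Finset.sum_eq_single j]
      · simp [u', hj, index_apply_self]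
      · intro l _ hlj
        rcases lt_or_gt_of_ne hlj with hlt | hgt
        · rw [hl l hlt, zero_mul]
        · have : u' l j.castSucc = 0 := by
            simp only [u']
            split_ifs
            · exact index_apply_of_lt u hgt
            · rfl
          rw [this, mul_zero]
      · intro h
        exact (h (Finset.mem_univ _)).elim
    have hc0 : ∀ j, j < i → c j = 0 := by
      intro j
      induction j using WellFoundedLT.induction with
      | ind j ihj =>
        intro hj
        rw [← hsingle j hj.le fun l hl => ihj l hl (hl.trans hj)]
        exact theta_lower v (x i) (lt_of_lt_of_le (Fin.castSucc_lt_castSucc_iff.2 hj) hpos)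
    have hyi := hsingle i le_rfl hc0
    have hyu : y = c i • u.1 i := by
      rw [← hc, Finset.sum_eq_single i]
      · simp [u']
      · intro l _ hl
        rcases lt_or_gt_of_ne hl with hlt | hgt
        · rw [hc0 l hlt, zero_smul]
        · simp [u', not_le.2 hgt]
      · intro h
        exact (h (Finset.mem_univ _)).elim
    have hypos : y (x i).pos = 1 := theta_pos v (x i)
    have hci : c i ≠ 0 := by
      intro h0
      rw [hyu, h0, zero_smul] at hypos
      exact zero_ne_one hypos
    have hpeq : (x i).pos = i.castSucc := by
      refine le_antisymm (not_lt.1 fun hlt => hci ?_) hpos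
      rw [← hyi]
      exact theta_lower v (x i) hlt
    rw [hpeq, hyi] at hypos
    rw [hypos, one_smul] at hyu
    cases hxi : x i with
    | b =>
      rw [hxi] at hpeq
      exact ((Fin.castSucc_lt_last i).ne hpeq.symm).elim
    | a j ε =>
      rw [hxi] at hpeq
      obtain rfl : j = i := Fin.castSucc_injective m hpeq
      cases ε with
      | false =>
        rw [hy, hxi] at hyu
        -- The condition u_j ≠ e_j of the index set excludes the vertex a_j^0.
        exact ((u.2 j).2 hyu.symm).elim
      | true =>
        rw [hy, hxi] at hyu
        exact ⟨rfl, hyu⟩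

theorem coeff_chainMap_cChain (v u : IndexT F m) :
    coeff ((fMap v).chainMap (taut F m) m (cChain v)) (baseFlag u).1.1 =
      if v = u then (-1 : ℤ) ^ m • wVec (seqV v fun _ => true) else 0 := by
  have hterm : ∀ (x : Fin m → Vertex m) (hx : Finset.univ.image x ∈ (coneComplex m).faces)
      (hinj : Function.Injective x) (y : (hSystem v).obj (flagSimplex x hx hinj).1),
      coeff ((fMap v).chainMap (taut F m) m ((hSystem v).single (flagSimplex x hx hinj) y))
        (baseFlag u).1.1 =
      if ((fMap v).mapSimplex (flagSimplex x hx hinj)).1.1 = (baseFlag u).1.1 then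
        (y : Fin (m + 1) → F) else 0 := by
    intro x hx hinj y
    rw [coeff, OrderedMap.chainMap_single, LocalSystem.toFinsupp_single, Finsupp.single_apply]
    rfl
  have hadd : ∀ a b : (hSystem v).Chain m,
      coeff ((fMap v).chainMap (taut F m) m (a + b)) (baseFlag u).1.1 =
      coeff ((fMap v).chainMap (taut F m) m a) (baseFlag u).1.1 +
      coeff ((fMap v).chainMap (taut F m) m b) (baseFlag u).1.1 := by
    intro a b
    rw [coeff, map_add, map_add]
    rfl
  let Λ : (hSystem v).Chain m →+ (Fin (m + 1) → F) := AddMonoidHom.mk'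
    (fun a => coeff ((fMap v).chainMap (taut F m) m a) (baseFlag u).1.1) hadd
  have hΛ : ∀ (x : Fin m → Vertex m) (hx : Finset.univ.image x ∈ (coneComplex m).faces)
      (hinj : Function.Injective x) (y : (hSystem v).obj (flagSimplex x hx hinj).1),
      Λ ((hSystem v).single (flagSimplex x hx hinj) y) =
      if ((fMap v).mapSimplex (flagSimplex x hx hinj)).1.1 = (baseFlag u).1.1 then
        (y : Fin (m + 1) → F) else 0 := hterm
  change Λ (cChain v) = _
  rw [cChain, map_add]
  simp only [map_sum, map_zsmul, hΛ]
  have hB : ∀ (j : Fin m) (ε : Fin m → Bool) (π : Equiv.Perm (Fin m)),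
      ¬ ((fMap v).mapSimplex (flagSimplex (seqAB ε j ∘ π) (seqAB_mem ε j π)
        ((seqAB_injective ε j).comp π.injective))).1.1 = (baseFlag u).1.1 := by
    intro j ε π h
    have := (eq_of_mapSimplex_eq_baseFlag _ _ h (π.symm j)).1
    simp [seqAB] at this
  have hA : ∀ (ε : Fin m → Bool) (π : Equiv.Perm (Fin m)),
      ((fMap v).mapSimplex (flagSimplex (seqA ε ∘ π) (seqA_mem ε π)
        ((seqA_injective ε).comp π.injective))).1.1 = (baseFlag u).1.1 →
      (ε = fun _ => true) ∧ π = 1 ∧ v = u := by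
    intro ε π h
    have h' := eq_of_mapSimplex_eq_baseFlag _ _ h
    have hπ : π = 1 := by
      ext1 i
      have := (h' i).1
      simp only [Function.comp_apply, seqA, Vertex.a.injEq] at this
      exact this.1
    subst hπ
    refine ⟨?_, rfl, Subtype.ext (funext fun i => (h' i).2)⟩
    funext i
    have := (h' i).1
    simp only [Function.comp_apply, seqA, Vertex.a.injEq] at this
    exact this.2
  have hzero : (∑ j : Fin m, ∑ ε : Fin m → Bool with ε j = false, ∑ π : Equiv.Perm (Fin m),
      chi ε π • if ((fMap v).mapSimplex (flagSimplex (seqAB ε j ∘ π) (seqAB_mem ε j π)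
        ((seqAB_injective ε j).comp π.injective))).1.1 = (baseFlag u).1.1 then
          (coeffAB v j ε π : Fin (m + 1) → F) else 0) = 0 :=
    Finset.sum_eq_zero fun j _ => Finset.sum_eq_zero fun ε _ => Finset.sum_eq_zero fun π _ => by
      rw [if_neg (hB j ε π), smul_zero]
  rw [hzero, add_zero]
  by_cases hvu : v = u
  · subst hvu
    rw [if_pos rfl, Finset.sum_eq_single (fun _ => true), Finset.sum_eq_single 1, if_pos]
    -- The one surviving term has all ε_i = 1 and trivial permutation, whence the sign (-1)^m.
    · simp [chi, coeffA]
    · rfl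
    · intro π _ hπ
      rw [if_neg fun h => hπ (hA _ _ h).2.1, smul_zero]
    · intro h
      exact (h (Finset.mem_univ _)).elim
    · intro ε _ hε
      refine Finset.sum_eq_zero fun π _ => ?_
      rw [if_neg fun h => hε (hA _ _ h).1, smul_zero]
    · intro h
      exact (h (Finset.mem_univ _)).elim
  · rw [if_neg hvu]
    refine Finset.sum_eq_zero fun ε _ => Finset.sum_eq_zero fun π _ => ?_
    rw [if_neg fun h => hvu (hA _ _ h).2.2, smul_zero]

/-- A step of a generic flag different from the cut with e_i has a cutting vector different from
e_i, so the cutting vectors form an element of the index set. -/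
theorem IsGenericFlag.exists_index {L : List (Submodule F (Fin (m + 1) → F))}
    (h : IsGenericFlag ⊤ (stdList F m) L) :
    ∃ v : IndexT F m, properMembers L = (baseFlag v).1.1 := by
  obtain ⟨hlen, v, hv⟩ := h.exists_vectors
  have hL : L.length = m := by
    have : (stdList F m).length = m + 1 := by simp [stdList]
    omega
  have hi : ∀ i : Fin m, (i : ℕ) < L.length := fun i => by rw [hL]; exact i.2
  have hi' : ∀ i : Fin m, (i : ℕ) < (stdList F m).length := fun i => by
    rw [hlen]; exact (hi i).trans (Nat.lt_succ_self _)
  have hget : ∀ i : Fin m, (stdList F m)[(i : ℕ)]'(hi' i) = stdVec F i.castSucc := by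
    intro i
    simp only [stdList, List.getElem_ofFn]
    rfl
  refine ⟨⟨fun i => v i, fun i => ?_⟩, ?_⟩
  · obtain ⟨h1, h2, -⟩ := hv i (hi i) (hi' i)
    rw [hget] at h1 h2
    refine ⟨Submodule.span_mono ?_ h1, h2⟩
    intro x hx
    obtain ⟨k, hk, rfl⟩ := List.mem_iff_getElem.1 (show x ∈ List.drop _ _ from hx)
    rw [List.getElem_drop]
    simp only [stdList, List.getElem_ofFn]
    refine ⟨_, ?_, rfl⟩
    rw [Set.mem_Ioi, Fin.lt_def]
    simp only [Fin.val_castSucc]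
    omega
  · ext B
    rw [mem_properMembers, mem_baseFlag, List.mem_iff_getElem]
    constructor
    · rintro ⟨i, hiL, hB⟩
      refine ⟨⟨i, hL ▸ hiL⟩, fun u => ?_⟩
      rw [← hB, (hv i hiL (by omega)).2.2 u]
      simp only [Submodule.mem_top, true_and]
      constructor
      · intro h j hj
        exact h j hj
      · intro h j hj
        exact h ⟨j, by omega⟩ hj
    · rintro ⟨i, hB⟩
      refine ⟨i, hi i, ?_⟩
      ext u
      rw [hB, (hv i (hi i) (hi' i)).2.2 u]
      simp only [Submodule.mem_top, true_and]
      constructor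
      · intro h j hj
        exact h j hj
      · intro h j hj
        exact h ⟨j, by omega⟩ hj

/-! ### Coordinates on D¹(V) -/

variable (F m) in
/-- The signed last coordinates of the coefficients of a chain at the base flags. -/
def baseCoords : (taut F m).Chain m →ₗ[F] (IndexT F m → F) :=
  LinearMap.pi fun v => (-1 : F) ^ m • (LinearMap.proj (Fin.last m) ∘ₗ
    Finsupp.lapply (baseFlag v).1.1 ∘ₗ (taut F m).toFinsupp tautIncl m)

theorem baseCoords_apply (z : (taut F m).Chain m) (v : IndexT F m) :
    baseCoords F m z v = (-1) ^ m * coeff z (baseFlag v).1.1 (Fin.last m) := rfl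

theorem baseCoords_chainMap_cChain (v : IndexT F m) :
    baseCoords F m ((fMap v).chainMap (taut F m) m (cChain v)) = Pi.single v 1 := by
  funext u
  rw [baseCoords_apply, coeff_chainMap_cChain, Pi.single_apply]
  by_cases h : v = u
  · subst h
    have hw := (wVec_seqV v fun _ => true).2
    rw [dot_stdVec] at hw
    rw [if_pos rfl, if_pos rfl, Pi.smul_apply, hw, zsmul_one]
    push_cast
    rw [← mul_pow]
    simp
  · rw [if_neg h, if_neg (Ne.symm h)]
    simp

/-- The coefficient at the base flag of v is orthogonal to every v_j, so it vanishes together with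
its last coordinate. `cycle_eq_zero` then applies, since all generic flags are base flags. -/
theorem eq_zero_of_baseCoords [Fintype (ProperSubspace F m)] {z : (taut F m).Chain m}
    (hz : z ∈ (taut F m).cycles m) (h : baseCoords F m z = 0) : z = 0 := by
  refine cycle_eq_zero hz fun L hL => ?_
  obtain ⟨v, hv⟩ := hL.exists_index
  rw [hv]
  have hl := congrFun h v
  rw [baseCoords_apply, Pi.zero_apply, mul_eq_zero] at hl
  refine eq_zero_of_dot_eq_zero v (fun j => ?_) ?_
  · let B := fVertex v (prefixVertex (seqA (fun _ => true) ∘ (1 : Equiv.Perm (Fin m)))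
      (seqA_mem _ 1) j)
    have hB : B ∈ (baseFlag v).1.1 := (mem_mapSimplex_flagSimplex v _ _ _ B).2 ⟨j, rfl⟩
    exact (mem_fVertex_prefixVertex v _ _ j _).1 (coeff_mem z _ hB) j le_rfl
  · rw [dot_stdVec]
    exact hl.resolve_left (pow_ne_zero _ (neg_ne_zero.2 one_ne_zero))

/-- A chain of proper nonzero subspaces of V has at most n - 1 = m members. -/
theorem boundary_top_eq_zero (d : (taut F m).Chain (m + 1)) : (taut F m).boundary m d = 0 := by
  have : IsEmpty ((building F m).Simplex (m + 1)) := ⟨fun σ => by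
    have := card_le_of_mem_faces σ.1.2
    rw [σ.2] at this
    omega⟩
  have hd : d = 0 := DFinsupp.ext fun σ => isEmptyElim σ
  rw [hd, map_zero]

variable (F m) in
/-- The coordinates on `D¹(V)` given by the coefficients at the base flags. -/
def homologyCoords : D1 F m →ₗ[F] (IndexT F m → F) :=
  Submodule.liftQ _ (baseCoords F m ∘ₗ ((taut F m).cycles m).subtype) (by
    rintro ⟨z, hz⟩ ⟨d, hd⟩
    rw [boundary_top_eq_zero] at hd
    change baseCoords F m z = 0
    have : z = 0 := hd.symm
    rw [this, map_zero])

theorem homologyCoords_injective [Fintype (ProperSubspace F m)] :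
    Function.Injective (homologyCoords F m) := by
  rw [injective_iff_map_eq_zero]
  intro a ha
  obtain ⟨⟨z, hz⟩, rfl⟩ := Submodule.Quotient.mk_surjective _ a
  have h0 : baseCoords F m z = 0 := ha
  have := eq_zero_of_baseCoords hz h0
  subst this
  exact Submodule.Quotient.mk_zero _

theorem homologyCoords_class (v : IndexT F m) :
    homologyCoords F m ((fMap v).homologyMap (taut F m) m
      ((hSystem v).homologyClass (cChain v) (cChain_mem_cycles v))) = Pi.single v 1 :=
  baseCoords_chainMap_cChain v

end Evaluation

end TwistedBuilding

end

/-- With `n = m + 1` and `V = Fⁿ`: every `c_v` is a cycle, and the classes `(f_v)_* c_v`, indexed by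
`v ∈ T_{q,n}`, form a basis of `D¹(V)` over `F`. -/
theorem theorem2p2 (F : Type*) [Field F] [Finite F] (m : ℕ) :
    ∃ hc : ∀ v : TwistedBuilding.IndexT F m,
        TwistedBuilding.cChain v ∈ (TwistedBuilding.hSystem v).cycles m,
      ∃ B : Module.Basis (TwistedBuilding.IndexT F m) F (TwistedBuilding.D1 F m),
        ∀ v : TwistedBuilding.IndexT F m,
          B v = (TwistedBuilding.fMap v).homologyMap (TwistedBuilding.taut F m) m
            ((TwistedBuilding.hSystem v).homologyClass (TwistedBuilding.cChain v) (hc v)) := by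
  classical
  refine ⟨TwistedBuilding.cChain_mem_cycles, ?_⟩
  have : Finite (TwistedBuilding.ProperSubspace F m) :=
    Finite.of_injective (fun A => (A.val : Set (Fin (m + 1) → F)))
      fun A B h => TwistedBuilding.ProperSubspace.ext (SetLike.coe_injective h)
  have : Fintype (TwistedBuilding.ProperSubspace F m) := Fintype.ofFinite _
  have : Fintype (TwistedBuilding.IndexT F m) := Fintype.ofFinite _
  have hinj := TwistedBuilding.homologyCoords_injective (F := F) (m := m)
  have hclass : ∀ v : TwistedBuilding.IndexT F m, TwistedBuilding.homologyCoords F m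
      ((TwistedBuilding.fMap v).homologyMap (TwistedBuilding.taut F m) m
        ((TwistedBuilding.hSystem v).homologyClass (TwistedBuilding.cChain v)
          (TwistedBuilding.cChain_mem_cycles v))) = Pi.single v 1 := fun v => by
    convert TwistedBuilding.homologyCoords_class v
  -- The classes map to the standard basis of the functions on the finite index set, which gives
  -- surjectivity and, with injectivity, identifies them as the transported basis.
  have hsurj : Function.Surjective (TwistedBuilding.homologyCoords F m) := by
    intro g
    refine ⟨∑ v, g v • (TwistedBuilding.fMap v).homologyMap (TwistedBuilding.taut F m) m
      ((TwistedBuilding.hSystem v).homologyClass (TwistedBuilding.cChain v)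
        (TwistedBuilding.cChain_mem_cycles v)), ?_⟩
    simp only [map_sum, map_smul, hclass]
    exact (pi_eq_sum_univ' g).symm
  have hbij : Function.Bijective (TwistedBuilding.homologyCoords F m) := ⟨hinj, hsurj⟩
  refine ⟨Module.Basis.ofEquivFun (LinearEquiv.ofBijective _ hbij), fun v => ?_⟩
  rw [Module.Basis.coe_ofEquivFun, LinearEquiv.symm_apply_eq]
  exact (hclass v).symm
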